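/- Let $k$ be an arbitrary field and let $R=\begin{pmatrix} k & k^2\\ 0 & k\end{pmatrix}$ be the Kronecker algebra, with $k$-$k$-bimodule structure $a(b,c)d=(abd,acd)$ on $k^2$. Left $R$-modules are identified with representations $\alpha,\beta\colon M_2\rightrightarrows M_1$ of the Kronecker quiver, where $M_1=e_{1}M$, $M_2=e_{2}M$ for the diagonal matrix idempotents $e_1,e_2$, and $\alpha,\beta$ are the actions of the elements $(1,0),(0,1)\in k^2$. The defect of a finite-dimensional $R$-module $M$ is $\dim_k M_2-\dim_k M_1$. A finite-dimensional module is regular if all its indecomposable direct summands have defect $0$ (equivalently, if it has no nonzero preprojective or preinjective direct summand); a simple regular module is a nonzero regular module whose only regular submodules are $0$ and itself; a regular module has regular length $n$ if it has a chain of submodules of length $n$ from $0$ to itself with simple regular factors, and its regular socle is the sum of its simple regular submodules. For a simple regular module $U$ and $n\ge 1$ let $U[n]$ be the indecomposable regular module of regular length $n$ with regular socle isomorphic to $U$; the Prüfer module $U[\infty]=\varinjlim_n U[n]$ is a module that is the union of a chain of submodules $U[1]\subset U[2]\subset\cdots$. Let $V$ be the representation $k\rightrightarrows k$ with $\alpha=0$,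 $\beta=1$. For a monic irreducible polynomial $p(x)\in k[x]$ let $k_{p(x)}=k[x]/(p(x))$, and let $V_{p(x)}$ be the representation $k_{p(x)}\rightrightarrows k_{p(x)}$ with $\alpha=1$ and $\beta$ the multiplication by $x$. Then the Prüfer modules $V[\infty]$ and $V_{p(x)}[\infty]$ exist, and any such modules have endomorphism rings $$\operatorname{End}_R(V[\infty])\simeq k[[t]]\qquad\text{and}\qquad \operatorname{End}_R(V_{p(x)}[\infty])\simeq k_{p(x)}[[t]]$$ as rings, for every monic irreducible $p(x)\in k[x]$, where $t$ is a variable. -/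

import Mathlib

open Polynomial

universe u v w

/-- The Kronecker algebra over `k`: the ring of triangular matrices `(a, (c, d); 0, b)` with
`a, b ∈ k` and `(c, d)` in the bimodule `k²`. -/
@[ext]
structure KroneckerAlgebra (k : Type u) where
  /-- upper left entry -/
  a : k
  /-- first coordinate of the upper right entry -/
  c : k
  /-- second coordinate of the upper right entry -/
  d : k
  /-- lower right entry -/
  b : k

namespace KroneckerAlgebra

section Ring

variable {k : Type u} [Field k]

instance : Zero (KroneckerAlgebra k) := ⟨⟨0, 0, 0, 0⟩⟩

instance : One (KroneckerAlgebra k) := ⟨⟨1, 0, 0, 1⟩⟩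

instance : Add (KroneckerAlgebra k) :=
  ⟨fun r s => ⟨r.a + s.a, r.c + s.c, r.d + s.d, r.b + s.b⟩⟩

instance : Neg (KroneckerAlgebra k) := ⟨fun r => ⟨-r.a, -r.c, -r.d, -r.b⟩⟩

/-- Matrix multiplication. -/
instance : Mul (KroneckerAlgebra k) :=
  ⟨fun r s => ⟨r.a * s.a, r.a * s.c + r.c * s.b, r.a * s.d + r.d * s.b, r.b * s.b⟩⟩

instance : SMul k (KroneckerAlgebra k) := ⟨fun t r => ⟨t * r.a, t * r.c, t * r.d, t * r.b⟩⟩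

@[simp] theorem zero_a : (0 : KroneckerAlgebra k).a = 0 := rfl
@[simp] theorem zero_b : (0 : KroneckerAlgebra k).b = 0 := rfl
@[simp] theorem zero_c : (0 : KroneckerAlgebra k).c = 0 := rfl
@[simp] theorem zero_d : (0 : KroneckerAlgebra k).d = 0 := rfl
@[simp] theorem one_a : (1 : KroneckerAlgebra k).a = 1 := rfl
@[simp] theorem one_b : (1 : KroneckerAlgebra k).b = 1 := rfl
@[simp] theorem one_c : (1 : KroneckerAlgebra k).c = 0 := rfl
@[simp] theorem one_d : (1 : KroneckerAlgebra k).d = 0 := rfl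
@[simp] theorem add_a (r s : KroneckerAlgebra k) : (r + s).a = r.a + s.a := rfl
@[simp] theorem add_b (r s : KroneckerAlgebra k) : (r + s).b = r.b + s.b := rfl
@[simp] theorem add_c (r s : KroneckerAlgebra k) : (r + s).c = r.c + s.c := rfl
@[simp] theorem add_d (r s : KroneckerAlgebra k) : (r + s).d = r.d + s.d := rfl
@[simp] theorem neg_a (r : KroneckerAlgebra k) : (-r).a = -r.a := rfl
@[simp] theorem neg_b (r : KroneckerAlgebra k) : (-r).b = -r.b := rfl
@[simp] theorem neg_c (r : KroneckerAlgebra k) : (-r).c = -r.c := rfl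
@[simp] theorem neg_d (r : KroneckerAlgebra k) : (-r).d = -r.d := rfl
@[simp] theorem mul_a (r s : KroneckerAlgebra k) : (r * s).a = r.a * s.a := rfl
@[simp] theorem mul_b (r s : KroneckerAlgebra k) : (r * s).b = r.b * s.b := rfl
@[simp] theorem mul_c (r s : KroneckerAlgebra k) : (r * s).c = r.a * s.c + r.c * s.b := rfl
@[simp] theorem mul_d (r s : KroneckerAlgebra k) : (r * s).d = r.a * s.d + r.d * s.b := rfl
@[simp] theorem smul_a (t : k) (r : KroneckerAlgebra k) : (t • r).a = t * r.a := rfl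
@[simp] theorem smul_b (t : k) (r : KroneckerAlgebra k) : (t • r).b = t * r.b := rfl
@[simp] theorem smul_c (t : k) (r : KroneckerAlgebra k) : (t • r).c = t * r.c := rfl
@[simp] theorem smul_d (t : k) (r : KroneckerAlgebra k) : (t • r).d = t * r.d := rfl

instance : Ring (KroneckerAlgebra k) where
  add_assoc r s t := by ext <;> simp <;> ring
  zero_add r := by ext <;> simp
  add_zero r := by ext <;> simp
  add_comm r s := by ext <;> simp <;> ring
  neg_add_cancel r := by ext <;> simp
  mul_assoc r s t := by ext <;> simp <;> ring
  one_mul r := by ext <;> simp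
  mul_one r := by ext <;> simp
  left_distrib r s t := by ext <;> simp <;> ring
  right_distrib r s t := by ext <;> simp <;> ring
  zero_mul r := by ext <;> simp
  mul_zero r := by ext <;> simp
  nsmul := nsmulRec
  zsmul := zsmulRec

instance : Module k (KroneckerAlgebra k) where
  one_smul r := by ext <;> simp
  mul_smul s t r := by ext <;> simp <;> ring
  smul_zero t := by ext <;> simp
  smul_add t r s := by ext <;> simp <;> ring
  add_smul s t r := by ext <;> simp <;> ring
  zero_smul r := by ext <;> simp

instance : Algebra k (KroneckerAlgebra k) :=
  Algebra.ofModule (fun t r s => by ext <;> simp <;> ring) (fun t r s => by ext <;> simp <;> ring)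

/-- The idempotent of the vertex `1`, the sink of the Kronecker quiver. -/
def e₁ (k : Type u) [Field k] : KroneckerAlgebra k := ⟨1, 0, 0, 0⟩

/-- The idempotent of the vertex `2`, the source of the Kronecker quiver. -/
def e₂ (k : Type u) [Field k] : KroneckerAlgebra k := ⟨0, 0, 0, 1⟩

end Ring

section Rep

variable {k : Type u} [Field k] {M₁ : Type v} {M₂ : Type w} [AddCommGroup M₁] [AddCommGroup M₂]
  [Module k M₁] [Module k M₂]

/-- The module over the Kronecker algebra given by the representation
`α, β : M₂ ⇉ M₁` of the Kronecker quiver; its underlying space is `M₁ × M₂`. -/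
def Rep (_α _β : M₂ →ₗ[k] M₁) : Type (max v w) := M₁ × M₂

variable (α β : M₂ →ₗ[k] M₁)

instance : AddCommGroup (Rep α β) := inferInstanceAs (AddCommGroup (M₁ × M₂))

instance : Module k (Rep α β) := inferInstanceAs (Module k (M₁ × M₂))

instance : SMul (KroneckerAlgebra k) (Rep α β) :=
  ⟨fun r m => (r.a • m.1 + r.c • α m.2 + r.d • β m.2, r.b • m.2)⟩

@[simp] theorem Rep.smul_fst (r : KroneckerAlgebra k) (m : Rep α β) :
    (r • m).1 = r.a • m.1 + r.c • α m.2 + r.d • β m.2 := rfl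

@[simp] theorem Rep.smul_snd (r : KroneckerAlgebra k) (m : Rep α β) : (r • m).2 = r.b • m.2 := rfl

@[simp] theorem Rep.add_fst (m n : Rep α β) : (m + n).1 = m.1 + n.1 := rfl

@[simp] theorem Rep.add_snd (m n : Rep α β) : (m + n).2 = m.2 + n.2 := rfl

@[simp] theorem Rep.zero_fst : (0 : Rep α β).1 = 0 := rfl

@[simp] theorem Rep.zero_snd : (0 : Rep α β).2 = 0 := rfl

@[simp] theorem Rep.field_smul_fst (t : k) (m : Rep α β) : (t • m).1 = t • m.1 := rfl

@[simp] theorem Rep.field_smul_snd (t : k) (m : Rep α β) : (t • m).2 = t • m.2 := rfl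

instance : Module (KroneckerAlgebra k) (Rep α β) where
  one_smul m := by
    refine Prod.ext ?_ ?_ <;> simp
  mul_smul r s m := by
    refine Prod.ext ?_ ?_ <;> simp [mul_smul, add_smul]
    abel
  smul_zero r := by
    refine Prod.ext ?_ ?_ <;> simp
  smul_add r m n := by
    refine Prod.ext ?_ ?_ <;> simp
    abel
  add_smul r s m := by
    refine Prod.ext ?_ ?_ <;> simp [add_smul]
    abel
  zero_smul m := by
    refine Prod.ext ?_ ?_ <;> simp

instance : IsScalarTower k (KroneckerAlgebra k) (Rep α β) where
  smul_assoc t r m := by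
    refine Prod.ext ?_ ?_ <;> simp [mul_smul]

end Rep

/-- The representation `V`, with `α = 0` and `β = 1` on `k`. -/
abbrev V (k : Type u) [Field k] : Type u :=
  Rep (0 : k →ₗ[k] k) (LinearMap.id : k →ₗ[k] k)

/-- The representation `V_p`, with `α = 1` and `β` the multiplication by `x` on `k[x]/(p)`. -/
abbrev Vp {k : Type u} [Field k] (p : k[X]) : Type u :=
  Rep (LinearMap.id : AdjoinRoot p →ₗ[k] AdjoinRoot p)
    (LinearMap.mulLeft k (AdjoinRoot.root p))

/-- A module is indecomposable if it is nonzero and is not the direct sum of two nonzero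
submodules. -/
def IsIndecomposable (R : Type u) (M : Type v) [Ring R] [AddCommGroup M] [Module R M] : Prop :=
  Nontrivial M ∧ ∀ A B : Submodule R M, IsCompl A B → A = ⊥ ∨ B = ⊥

section Regular

/- Modules over the Kronecker algebra carry the `k`-vector space structure that comes from
`k → KroneckerAlgebra k`; this is what `IsScalarTower k (KroneckerAlgebra k) M` says. -/
variable (k : Type u) [Field k] (M : Type v) [AddCommGroup M] [Module k M]
  [Module (KroneckerAlgebra k) M] [IsScalarTower k (KroneckerAlgebra k) M]

/-- The subspace `e M` of a module `M`. -/
def cornerSpace (e : KroneckerAlgebra k) : Submodule k M :=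
  LinearMap.range (Algebra.lsmul k k M e)

/-- The defect `⟨δ, dim M⟩` of a finite-dimensional module, where `δ = (1, 1)` and
`⟨x, y⟩ = x₁ y₁ + x₂ y₂ - 2 x₂ y₁` is the Euler form of the Kronecker quiver, that is,
`dim e₂ M - dim e₁ M`. -/
noncomputable def defect : ℤ :=
  (Module.finrank k (cornerSpace k M (e₂ k)) : ℤ) - Module.finrank k (cornerSpace k M (e₁ k))

/-- Regular modules: finite-dimensional modules all of whose indecomposable direct summands have
defect zero (the indecomposable modules of negative and of positive defect are the
preprojective and the preinjective ones). -/
def IsRegular : Prop :=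
  Module.Finite k M ∧
    ∀ A B : Submodule (KroneckerAlgebra k) M, IsCompl A B →
      IsIndecomposable (KroneckerAlgebra k) A → defect k A = 0

/-- Simple regular modules: nonzero regular modules without regular submodules other than zero
and the whole module. -/
def IsSimpleRegular : Prop :=
  Nontrivial M ∧ IsRegular k M ∧
    ∀ N : Submodule (KroneckerAlgebra k) M, IsRegular k N → N = ⊥ ∨ N = ⊤

/-- `M` has a regular composition series of length `n`. -/
def HasRegularLength (n : ℕ) : Prop :=
  ∃ c : ℕ → Submodule (KroneckerAlgebra k) M, c 0 = ⊥ ∧ c n = ⊤ ∧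
    ∀ i < n, c i ≤ c (i + 1) ∧ IsSimpleRegular k (c (i + 1) ⧸ (c i).submoduleOf (c (i + 1)))

/-- The regular socle: the sum of all simple regular submodules. -/
def regularSocle : Submodule (KroneckerAlgebra k) M :=
  sSup {N | IsSimpleRegular k N}

variable (U : Type w) [AddCommGroup U] [Module (KroneckerAlgebra k) U]

/-- `M` is (isomorphic to) the module `U[n]`: the indecomposable regular module of regular length
`n` with regular socle `U`. -/
def IsRayModule (n : ℕ) : Prop :=
  IsIndecomposable (KroneckerAlgebra k) M ∧ IsRegular k M ∧ HasRegularLength k M n ∧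
    Nonempty (regularSocle k M ≃ₗ[KroneckerAlgebra k] U)

/-- `M` is (isomorphic to) the Prüfer module `U[∞]`: the union of a chain
`U[1] ⊆ U[2] ⊆ ⋯` of submodules. -/
def IsPrufer : Prop :=
  ∃ c : ℕ → Submodule (KroneckerAlgebra k) M, Monotone c ∧ (⨆ n, c n) = ⊤ ∧
    ∀ n, 1 ≤ n → IsRayModule k (c n) U n

end Regular

end KroneckerAlgebra

/-! A `k[X]`-module `P` gives a representation on two copies of `P`, with one arrow the identity and
the other the multiplication by `X` (`PolyRep`). This functor is fully faithful. The identity arrow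
embeds the source part of any submodule into its sink part, so a finite-dimensional submodule has
defect at most zero, with equality only if it comes from a `k[X]`-submodule
(`PolyRep.exists_eq_sub`). Regular submodules and socles can thus be read off from `k[X]`-modules.
`V_p` corresponds to `k[X]/(p)`, and `V` to `k[X]/(X)` with the arrows exchanged.

Existence: the `p`-primary part of `k(X)/k[X]` is `p`-divisible with simple socle, and its `p ^
n`-torsion gives `U[n]`.

Conversely, let `M` be any Prüfer module on `U`. A nonzero source element of `U[n]` killed by the
arrow that is bijective on `U` would generate a simple regular module on which this arrow is zero,
inside the socle `U`, which is absurd. Hence that arrow is bijective on `M`, and `M` comes from a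
`k[X]`-module `P`. Fitting's decomposition makes `P` `p`-primary with simple socle; being
infinite-dimensional it is not cyclic, hence it is divisible (`exists_span_eq_top_or`).

Endomorphisms of such a `P`: the field `K = k[X]/(p)` lifts to the `p`-adic completion of `k[X]`, by
formal smoothness over the prime field; if `K/k` is inseparable the lift need not be `k`-linear. The
completion acts on `P`, so `K` does too. With `t` the multiplication by `p`, an endomorphism agrees
on the socle with some element of `K`, the difference factors through `t`, and iteration expands it
as a power series in `t` (`nonempty_end_ringEquiv_powerSeries`). -/

/-! ### Formal smoothness over perfect fields and coefficient fields -/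

section FormallySmooth

open MvPolynomial KaehlerDifferential TensorProduct

/-- The class of `1 ⊗ df` in `A ⊗ Ω` vanishes iff all partial derivatives of `f` vanish in `A`. -/
theorem MvPolynomial.one_tmul_D_eq_zero_iff {R A σ : Type*} [CommRing R] [CommRing A]
    [Algebra (MvPolynomial σ R) A] (f : MvPolynomial σ R) :
    (1 : A) ⊗ₜ[MvPolynomial σ R] D R (MvPolynomial σ R) f = 0 ↔
      ∀ i, algebraMap (MvPolynomial σ R) A (pderiv i f) = 0 := by
  rw [← ((mvPolynomialBasis R σ).baseChange A).repr.map_eq_zero_iff, Finsupp.ext_iff]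
  refine forall_congr' fun i => ?_
  rw [Module.Basis.baseChange_repr_tmul, mvPolynomialBasis_repr_apply, Algebra.smul_def, mul_one]
  rfl

/-- The Jacobian criterion for the vanishing of the first cotangent homology. -/
theorem Algebra.H1Cotangent.subsingleton_iff_mvPolynomial {R A σ : Type*} [CommRing R] [CommRing A]
    [Algebra R A] (φ : MvPolynomial σ R →ₐ[R] A) (hφ : Function.Surjective φ) :
    Subsingleton (Algebra.H1Cotangent R A) ↔
      ∀ f, φ f = 0 → (∀ i, φ (pderiv i f) = 0) → f ∈ (RingHom.ker φ.toRingHom) ^ 2 := by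
  let : Algebra (MvPolynomial σ R) A := φ.toRingHom.toAlgebra
  have : IsScalarTower R (MvPolynomial σ R) A := .of_algebraMap_eq fun r => (φ.commutes r).symm
  rw [← Algebra.FormallySmooth.kerCotangentToTensor_injective_iff (P := MvPolynomial σ R) hφ,
    injective_iff_map_eq_zero]
  constructor
  · intro h f hf hd
    have := h (Ideal.toCotangent _ ⟨f, hf⟩) (by
      rw [kerCotangentToTensor_toCotangent]
      exact (one_tmul_D_eq_zero_iff f).2 hd)
    exact (Ideal.toCotangent_eq_zero _ _).1 this
  · intro h x hx
    obtain ⟨⟨f, hf⟩, rfl⟩ := Ideal.toCotangent_surjective _ x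
    rw [kerCotangentToTensor_toCotangent] at hx
    exact (Ideal.toCotangent_eq_zero _ _).2 (h f hf ((one_tmul_D_eq_zero_iff f).1 hx))

/-- Every field extension of a perfect field is formally smooth. -/
theorem Algebra.FormallySmooth.of_perfectField_base (K L : Type*) [Field K] [Field L] [Algebra K L]
    [PerfectField K] : Algebra.FormallySmooth K L := by
  refine ⟨inferInstance, ?_⟩
  rw [Algebra.H1Cotangent.subsingleton_iff_mvPolynomial (MvPolynomial.aeval (_root_.id : L → L))
    (fun x => ⟨MvPolynomial.X x, by simp⟩)]
  intro f hf hd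
  -- The relation `f` involves finitely many elements of `L`. Over the subfield they generate the
  -- result is known, and the Jacobian criterion passes from there to `L`.
  let F : IntermediateField K L := IntermediateField.adjoin K (f.vars : Set L)
  have : Algebra.EssFiniteType K F :=
    IntermediateField.essFiniteType_iff.2 (IntermediateField.fg_adjoin_finset f.vars)
  have hF : Subsingleton (Algebra.H1Cotangent K F) :=
    (Algebra.FormallySmooth.of_perfectField (K := K) (L := F)).subsingleton_h1Cotangent
  rw [Algebra.H1Cotangent.subsingleton_iff_mvPolynomial (MvPolynomial.aeval (_root_.id : F → F))
    (fun x => ⟨MvPolynomial.X x, by simp⟩)] at hF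
  obtain ⟨g, hgf⟩ := exists_rename_eq_of_vars_subset_range f (Subtype.val : F → L)
    Subtype.val_injective (fun x hx => by
      rw [Subtype.range_coe]; exact IntermediateField.subset_adjoin K _ hx)
  rw [← hgf] at hf hd ⊢
  have key (q : MvPolynomial F K) : aeval (_root_.id : L → L) (rename Subtype.val q) =
      algebraMap F L (aeval (_root_.id : F → F) q) := by
    rw [aeval_rename]
    exact (aeval_algebraMap_apply L (_root_.id : F → F) q)
  have inj := FaithfulSMul.algebraMap_injective F L
  have hg := hF g (inj (by rw [← key, hf, map_zero])) fun i => inj (by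
    rw [← key, ← pderiv_rename Subtype.val_injective, hd, map_zero])
  have hle : (RingHom.ker (aeval (_root_.id : F → F) : MvPolynomial F K →ₐ[K] F).toRingHom).map
      (rename (Subtype.val : F → L) : MvPolynomial F K →ₐ[K] MvPolynomial L K).toRingHom ≤
      RingHom.ker (aeval (_root_.id : L → L) : MvPolynomial L K →ₐ[K] L).toRingHom := by
    rw [Ideal.map_le_iff_le_comap]
    intro q hq
    have hq' : aeval (_root_.id : F → F) q = 0 := hq
    change aeval (_root_.id : L → L) (rename Subtype.val q) = 0
    rw [key, hq', map_zero]
  refine Ideal.pow_right_mono hle 2 ?_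
  rw [← Ideal.map_pow]
  exact Ideal.mem_map_of_mem _ hg

end FormallySmooth

/-- An equal characteristic form of the existence of coefficient fields: the residue field of a
maximal ideal lifts to the adic completion of an algebra over a field. -/
theorem AdicCompletion.exists_section {k S : Type*} [Field k] [CommRing S] [Algebra k S]
    (I : Ideal S) [hI : I.IsMaximal] :
    ∃ σ : S ⧸ I →+* AdicCompletion I S, ∀ a, AdicCompletion.evalOneₐ I (σ a) = a := by
  let := Ideal.Quotient.field I
  -- The prime field is perfect, so `S ⧸ I` is formally smooth over it, even where it is inseparable
  -- over `k`; the identity of `S ⧸ I` then lifts to the completion.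
  obtain ⟨p, hp⟩ := CharP.exists k
  rcases CharP.char_is_prime_or_zero k p with h | rfl
  · have : Fact p.Prime := ⟨h⟩
    let : Algebra (ZMod p) k := ZMod.algebra k p
    let : Algebra (ZMod p) S := ((algebraMap k S).comp (algebraMap (ZMod p) k)).toAlgebra
    have := Algebra.FormallySmooth.of_perfectField_base (ZMod p) (S ⧸ I)
    obtain ⟨g, hg⟩ := Algebra.FormallySmooth.exists_adicCompletionEvalOneₐ_comp_eq
      (AlgHom.id (ZMod p) (S ⧸ I))
    exact ⟨g, fun a => DFunLike.congr_fun hg a⟩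
  · have : CharZero k := CharP.charP_to_charZero k
    let : Algebra ℚ S := ((algebraMap k S).comp (algebraMap ℚ k)).toAlgebra
    have := Algebra.FormallySmooth.of_perfectField_base ℚ (S ⧸ I)
    obtain ⟨g, hg⟩ := Algebra.FormallySmooth.exists_adicCompletionEvalOneₐ_comp_eq
      (AlgHom.id ℚ (S ⧸ I))
    exact ⟨g, fun a => DFunLike.congr_fun hg a⟩

/-! ### Endomorphisms of divisible primary modules -/

/-- Let `Ŝ` be a ring whose elements are approximated by elements of `S` modulo all powers of `π`,
`D n a f` saying that `f` approximates `a` modulo `π ^ n`. An action of `S` on a module by locally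
`π`-nilpotent endomorphisms extends to `Ŝ`. -/
theorem exists_ringHom_of_approx {T P S Ŝ : Type*} [Ring T] [AddCommGroup P] [Module T P]
    [CommRing S] [CommRing Ŝ] (π : S) (θ : S →+* Module.End T P)
    (htors : ∀ m, ∃ n, θ (π ^ n) m = 0) (D : ℕ → Ŝ → S → Prop)
    (hex : ∀ n a, ∃ f, D n a f) (hmono : ∀ m n a f, m ≤ n → D n a f → D m a f)
    (huniq : ∀ n a f g, D n a f → D n a g → π ^ n ∣ f - g) (hone : ∀ n, D n 1 1)
    (hadd : ∀ n a b f g, D n a f → D n b g → D n (a + b) (f + g))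
    (hmul : ∀ n a b f g, D n a f → D n b g → D n (a * b) (f * g)) :
    ∃ ρ : Ŝ →+* Module.End T P, ∀ n a f m, θ (π ^ n) m = 0 → D n a f → ρ a m = θ f m := by
  choose N hN using htors
  choose F hF using hex
  have hle (m : P) (n l : ℕ) (h : n ≤ l) (hn : θ (π ^ n) m = 0) : θ (π ^ l) m = 0 := by
    rw [← Nat.sub_add_cancel h, pow_add, map_mul, Module.End.mul_apply, hn, map_zero]
  -- Independence of the approximation: both agree modulo `π ^ min n (N m)`, which kills `m` because
  -- the minimum is one of the two exponents.
  have key (n : ℕ) (a : Ŝ) (f : S) (m : P) (hn : θ (π ^ n) m = 0) (hD : D n a f) :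
      θ (F (N m) a) m = θ f m := by
    have h0 : θ (π ^ min n (N m)) m = 0 := by
      rcases min_choice n (N m) with h | h <;> rw [h]
      exacts [hn, hN m]
    obtain ⟨c, hc⟩ := huniq (min n (N m)) a _ _ (hmono _ _ _ _ (min_le_right _ _) (hF (N m) a))
      (hmono _ _ _ _ (min_le_left _ _) hD)
    rw [← sub_eq_zero, ← LinearMap.sub_apply, ← map_sub, hc, mul_comm, map_mul,
      Module.End.mul_apply, h0, map_zero]
  let ρ (a : Ŝ) : Module.End T P :=
    { toFun := fun m => θ (F (N m) a) m
      map_add' := fun x y => by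
        have hx := hle x _ _ (le_max_left (N x) (N y)) (hN x)
        have hy := hle y _ _ (le_max_right (N x) (N y)) (hN y)
        rw [key _ a _ x hx (hF _ a), key _ a _ y hy (hF _ a),
          key _ a _ (x + y) (by rw [map_add, hx, hy, add_zero]) (hF (max (N x) (N y)) a), map_add]
      map_smul' := fun t x => by
        rw [key (N x) a _ (t • x) (by rw [map_smul, hN, smul_zero]) (hF (N x) a), map_smul]
        rfl }
  have hρ (n a f m) (hn : θ (π ^ n) m = 0) (hD : D n a f) : ρ a m = θ f m := key n a f m hn hD
  refine ⟨RingHom.mk' ⟨⟨ρ, ?_⟩, ?_⟩ ?_, hρ⟩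
  · ext m
    rw [hρ (N m) 1 1 m (hN m) (hone _), map_one]
  · intro a b
    ext m
    have h1 := hF (N m) a
    have h2 := hF (N m) b
    rw [hρ _ _ _ m (hN m) (hmul _ _ _ _ _ h1 h2), Module.End.mul_apply, hρ _ _ _ m (hN m) h2,
      hρ _ _ _ _ _ h1, map_mul, Module.End.mul_apply]
    rw [← Module.End.mul_apply, ← map_mul, mul_comm, map_mul, Module.End.mul_apply, hN, map_zero]
  · intro a b
    ext m
    change ρ (a + b) m = ρ a m + ρ b m
    have h1 := hF (N m) a
    have h2 := hF (N m) b
    rw [hρ _ _ _ m (hN m) (hadd _ _ _ _ _ h1 h2), hρ _ _ _ m (hN m) h1, hρ _ _ _ m (hN m) h2,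
      map_add, LinearMap.add_apply]

section EndRing

variable {S P : Type*} [CommRing S] [AddCommGroup P] [Module S P] {π : S}

/-- This lets a coefficient field of the completion act on `P`. -/
theorem exists_adicCompletion_hom (htors : ∀ m : P, ∃ n : ℕ, π ^ n • m = 0) :
    ∃ ρ : AdicCompletion (Ideal.span {π}) S →+* Module.End S P,
      ∀ (n : ℕ) a f (m : P), π ^ n • m = 0 →
        AdicCompletion.evalₐ _ n a = Ideal.Quotient.mk _ f → ρ a m = f • m := by
  refine exists_ringHom_of_approx π (algebraMap S (Module.End S P)) htors
    (fun n a f => AdicCompletion.evalₐ _ n a = Ideal.Quotient.mk _ f) ?_ ?_ ?_ ?_ ?_ ?_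
  · intro n a
    obtain ⟨f, hf⟩ := Ideal.Quotient.mk_surjective (AdicCompletion.evalₐ _ n a)
    exact ⟨f, hf.symm⟩
  · intro m n a f hmn h
    have := congrArg (Ideal.Quotient.factor (Ideal.pow_le_pow_right hmn)) h
    rw [Ideal.Quotient.factor_mk] at this
    rw [← this]
    obtain ⟨x, rfl⟩ := AdicCompletion.mk_surjective _ _ a
    rw [AdicCompletion.evalₐ_mk, AdicCompletion.evalₐ_mk, Ideal.Quotient.factor_mk]
    exact (AdicCompletion.Ideal.mk_eq_mk _ hmn x).symm
  · intro n a f g hf hg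
    rw [hf, Ideal.Quotient.eq, Ideal.span_singleton_pow, Ideal.mem_span_singleton] at hg
    exact hg
  · intro n
    simp
  · intro n a b f g hf hg
    rw [map_add, map_add, hf, hg]
  · intro n a b f g hf hg
    rw [map_mul, map_mul, hf, hg]

/-- Applied with `X` acting as multiplication by `π` and the coefficients through the coefficient
field, this yields the map that turns out to be the isomorphism. -/
theorem exists_powerSeries_hom {K T : Type*} [CommRing K] [Ring T] [Module T P]
    (θ : K[X] →+* Module.End T P) (htors : ∀ m, ∃ n, θ (X ^ n) m = 0) :
    ∃ ρ : PowerSeries K →+* Module.End T P, ∀ (n : ℕ) a (f : K[X]) m, θ (X ^ n) m = 0 →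
      PowerSeries.X ^ n ∣ a - (f : PowerSeries K) → ρ a m = θ f m := by
  refine exists_ringHom_of_approx X θ htors
    (fun n a f => PowerSeries.X ^ n ∣ a - (f : PowerSeries K)) ?_ ?_ ?_ ?_ ?_ ?_
  · intro n a
    refine ⟨a.trunc n, ?_⟩
    rw [PowerSeries.X_pow_dvd_iff]
    intro m hm
    rw [map_sub, Polynomial.coeff_coe, PowerSeries.coeff_trunc, if_pos hm, sub_self]
  · intro m n a f hmn h
    exact (pow_dvd_pow _ hmn).trans h
  · intro n a f g hf hg
    have := dvd_sub hg hf
    rw [sub_sub_sub_cancel_left, ← Polynomial.coe_sub, PowerSeries.X_pow_dvd_iff] at this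
    rw [Polynomial.X_pow_dvd_iff]
    intro d hd
    rw [← Polynomial.coeff_coe, this d hd]
  · intro n
    simp
  · intro n a b f g hf hg
    have := dvd_add hf hg
    rwa [sub_add_sub_comm, ← Polynomial.coe_add] at this
  · intro n a b f g hf hg
    have : a * b - ((f * g : K[X]) : PowerSeries K) =
        (a - (f : PowerSeries K)) * b + f * (b - (g : PowerSeries K)) := by
      rw [Polynomial.coe_mul]; ring
    rw [this]
    exact dvd_add (hf.mul_right _) (hg.mul_left _)

/-- The endomorphism ring of a Prüfer module at a principal maximal ideal of an algebra over a
field is a power series ring over the residue field. -/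
theorem nonempty_end_ringEquiv_powerSeries (k : Type*) [Field k] [Algebra k S]
    [hmax : (Ideal.span {π}).IsMaximal]
    (htors : ∀ m : P, ∃ n : ℕ, π ^ n • m = 0) (hsurj : ∀ m : P, ∃ m', π • m' = m)
    {v : P} (hv0 : v ≠ 0) (hv : π • v = 0) (hspan : ∀ w : P, π • w = 0 → ∃ f : S, w = f • v) :
    Nonempty (Module.End S P ≃+* PowerSeries (S ⧸ Ideal.span {π})) := by
  let _ := Ideal.Quotient.field (Ideal.span {π})
  obtain ⟨s, hs⟩ := AdicCompletion.exists_section (k := k) (Ideal.span {π})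
  obtain ⟨r, hr⟩ := exists_adicCompletion_hom htors
  let σ := r.comp s
  let t : Module.End S P := algebraMap S _ π
  have ht (m : P) : t m = π • m := rfl
  have htn (n : ℕ) (m : P) : (t ^ n) m = π ^ n • m := by
    rw [← map_pow]; rfl
  -- On the socle the coefficient field acts as the residue field does, because `s` is a section of
  -- reduction modulo `π`.
  have hσ (f : S) (m : P) (hm : π • m = 0) : σ (Ideal.Quotient.mk _ f) m = f • m := by
    refine hr 1 _ f m (by rwa [pow_one]) ?_
    have h1 := hs (Ideal.Quotient.mk _ f)
    obtain ⟨g, hg⟩ := Ideal.Quotient.mk_surjective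
      (AdicCompletion.evalₐ _ 1 (s (Ideal.Quotient.mk _ f)))
    rw [← AdicCompletion.factorₐ_evalₐ_one, ← hg] at h1
    rw [← hg]
    have h2 := Ideal.Quotient.eq.1 h1
    rw [Ideal.Quotient.eq]
    simpa using h2
  let θ : (S ⧸ Ideal.span {π})[X] →+* Module.End S P :=
    Polynomial.eval₂RingHom' σ t fun a => (Algebra.commutes π (σ a)).symm
  have hθX : θ X = t := Polynomial.eval₂_X _ _
  obtain ⟨Φ, hΦ⟩ := exists_powerSeries_hom θ (fun m => by
    obtain ⟨n, hn⟩ := htors m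
    exact ⟨n, by rw [map_pow, hθX, htn, hn]⟩)
  have hΦX : Φ PowerSeries.X = t := by
    ext m
    obtain ⟨n, hn⟩ := htors m
    rw [hΦ n _ X m (by rw [map_pow, hθX, htn, hn]) (by simp), hθX]
  have htsurj : ∀ n : ℕ, Function.Surjective (t ^ n) := fun n => by
    rw [Module.End.coe_pow]
    exact Function.Surjective.iterate hsurj n
  refine ⟨(RingEquiv.ofBijective Φ ⟨?_, ?_⟩).symm⟩
  · rw [injective_iff_map_eq_zero]
    intro F hF
    by_contra hne
    -- A nonzero series is a power of `X` times a unit; its vanishing on `P` would make a power of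
    -- the surjective map `t` zero, although `v ≠ 0`.
    have hu : IsUnit F.divXPowOrder := by
      rw [PowerSeries.isUnit_iff_constantCoeff, isUnit_iff_ne_zero,
        PowerSeries.constantCoeff_divXPowOrder]
      exact PowerSeries.coeff_order hne
    rw [← PowerSeries.X_pow_order_mul_divXPowOrder (f := F), map_mul,
      (hu.map Φ).mul_left_eq_zero, map_pow, hΦX] at hF
    obtain ⟨m, hm⟩ := htsurj F.order.toNat v
    rw [hF] at hm
    exact hv0 hm.symm
  -- `φ` preserves the socle `S v`, where it is multiplication by some `f`. The difference from `σ
  -- f` kills `ker t`, so it factors through the surjection `t`.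
  · have step (φ : Module.End S P) : ∃ a, ∃ ψ : Module.End S P, φ = σ a + ψ * t := by
      obtain ⟨f, hf⟩ := hspan (φ v) (by rw [← map_smul, hv, map_zero])
      have hker : LinearMap.ker t ≤ LinearMap.ker (φ - σ (Ideal.Quotient.mk _ f)) := by
        intro w hw
        obtain ⟨g, rfl⟩ := hspan w hw
        rw [LinearMap.mem_ker, map_smul, LinearMap.sub_apply, hf, hσ f v hv, sub_self, smul_zero]
      let e := t.quotKerEquivOfSurjective hsurj
      refine ⟨Ideal.Quotient.mk _ f, (Submodule.liftQ _ _ hker) ∘ₗ e.symm.toLinearMap, ?_⟩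
      rw [eq_comm, ← eq_sub_iff_add_eq']
      ext m
      have : e.symm (t m) = Submodule.Quotient.mk m := by
        rw [LinearEquiv.symm_apply_eq]; rfl
      simp [this]
    choose a ψ hψ using step
    intro φ
    let φs : ℕ → Module.End S P := fun n => Nat.rec φ (fun _ φ' => ψ φ') n
    have hφs (n : ℕ) : φs n = σ (a (φs n)) + φs (n + 1) * t := hψ (φs n)
    let F : PowerSeries (S ⧸ Ideal.span {π}) := PowerSeries.mk fun n => a (φs n)
    -- The remainder ends in `t ^ n`, so it vanishes on elements killed by `π ^ n`; on those `φ` is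
    -- the truncated series.
    have hsum (n : ℕ) : φ = θ (F.trunc n) + φs n * t ^ n := by
      induction n with
      | zero => simp [φs]
      | succ n ih =>
        have hmon : θ (monomial n (a (φs n))) = σ (a (φs n)) * t ^ n :=
          Polynomial.eval₂_monomial _ _
        rw [PowerSeries.trunc_succ, map_add, PowerSeries.coeff_mk, hmon, pow_succ', ← mul_assoc,
          add_assoc, ← add_mul, ← hφs]
        exact ih
    refine ⟨F, ?_⟩
    ext m
    obtain ⟨n, hn⟩ := htors m
    rw [hΦ n F (F.trunc n) m (by rw [map_pow, hθX, htn, hn])]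
    · conv_rhs => rw [hsum n]
      rw [LinearMap.add_apply, Module.End.mul_apply, htn, hn, map_zero, add_zero]
    · rw [PowerSeries.X_pow_dvd_iff]
      intro d hd
      rw [map_sub, Polynomial.coeff_coe, PowerSeries.coeff_trunc, if_pos hd, sub_self]

end EndRing

namespace KroneckerAlgebra

/-! ### Defect and regularity under isomorphisms and direct sums -/

section Transport

variable {k : Type u} [Field k] {M : Type v} [AddCommGroup M] [Module k M]
  [Module (KroneckerAlgebra k) M] [IsScalarTower k (KroneckerAlgebra k) M]
  {M' : Type w} [AddCommGroup M'] [Module k M']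
  [Module (KroneckerAlgebra k) M'] [IsScalarTower k (KroneckerAlgebra k) M']

/-- The corner space of a submodule, as a subspace of the ambient module. -/
def subCorner (N : Submodule (KroneckerAlgebra k) M) (e : KroneckerAlgebra k) : Submodule k M :=
  (cornerSpace k N e).map (N.subtype.restrictScalars k)

theorem mem_subCorner {N : Submodule (KroneckerAlgebra k) M} {e : KroneckerAlgebra k}
    (he : e * e = e) {m : M} : m ∈ subCorner N e ↔ m ∈ N ∧ e • m = m := by
  constructor
  · rintro ⟨_, ⟨n, rfl⟩, rfl⟩
    exact ⟨Submodule.coe_mem _, by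
      change e • e • (n : M) = e • (n : M)
      rw [← mul_smul, he]⟩
  · rintro ⟨h, h'⟩
    exact ⟨⟨m, h⟩, ⟨⟨m, h⟩, Subtype.ext h'⟩, rfl⟩

theorem finrank_subCorner (N : Submodule (KroneckerAlgebra k) M) (e : KroneckerAlgebra k) :
    Module.finrank k (subCorner N e) = Module.finrank k (cornerSpace k N e) :=
  (Submodule.equivMapOfInjective (N.subtype.restrictScalars k) N.subtype_injective
    (cornerSpace k N e)).finrank_eq.symm

theorem finrank_cornerSpace_congr (f : M ≃ₗ[KroneckerAlgebra k] M') (e : KroneckerAlgebra k) :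
    Module.finrank k (cornerSpace k M e) = Module.finrank k (cornerSpace k M' e) := by
  have : (cornerSpace k M e).map ((f.restrictScalars k : M ≃ₗ[k] M') : M →ₗ[k] M') =
      cornerSpace k M' e := by
    ext m
    constructor
    · rintro ⟨_, ⟨n, rfl⟩, rfl⟩
      exact ⟨f n, (f.map_smul e n).symm⟩
    · rintro ⟨n, rfl⟩
      refine ⟨e • f.symm n, ⟨f.symm n, rfl⟩, ?_⟩
      change f (e • f.symm n) = e • n
      rw [map_smul, f.apply_symm_apply]
  exact (LinearEquiv.ofSubmodules (f.restrictScalars k) _ _ this).finrank_eq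

theorem defect_congr (f : M ≃ₗ[KroneckerAlgebra k] M') : defect k M = defect k M' := by
  simp only [defect, finrank_cornerSpace_congr f]

theorem e₁_mul_e₁ : e₁ k * e₁ k = e₁ k := by ext <;> simp [e₁]

theorem e₂_mul_e₂ : e₂ k * e₂ k = e₂ k := by ext <;> simp [e₂]

theorem e₁_smul_add_e₂_smul {M : Type v} [AddCommGroup M]
    [Module (KroneckerAlgebra k) M] (m : M) : e₁ k • m + e₂ k • m = m := by
  rw [← add_smul]
  convert one_smul (KroneckerAlgebra k) m
  ext <;> simp [e₁, e₂]

theorem finrank_cornerSpace_of_isCompl [Module.Finite k M]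
    {A B : Submodule (KroneckerAlgebra k) M} (h : IsCompl A B) {e : KroneckerAlgebra k}
    (he : e * e = e) : Module.finrank k (cornerSpace k M e) =
      Module.finrank k (cornerSpace k A e) + Module.finrank k (cornerSpace k B e) := by
  rw [← finrank_subCorner A, ← finrank_subCorner B, ← Submodule.finrank_sup_add_finrank_inf_eq]
  have hinf : subCorner A e ⊓ subCorner B e = ⊥ := by
    rw [eq_bot_iff]
    rintro x ⟨hA, hB⟩
    exact (Submodule.disjoint_def.1 h.disjoint) x ((mem_subCorner he).1 hA).1
      ((mem_subCorner he).1 hB).1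
  have hsup : subCorner A e ⊔ subCorner B e = cornerSpace k M e := by
    apply le_antisymm
    · refine sup_le ?_ ?_ <;> intro x hx <;> exact ⟨x, ((mem_subCorner he).1 hx).2⟩
    · rintro _ ⟨n, rfl⟩
      obtain ⟨a, ha, b, hb, rfl⟩ := Submodule.mem_sup.1
        (show n ∈ A ⊔ B by rw [h.sup_eq_top]; trivial)
      change e • (a + b) ∈ _
      rw [smul_add]
      refine Submodule.add_mem_sup ((mem_subCorner he).2 ⟨A.smul_mem _ ha, ?_⟩)
        ((mem_subCorner he).2 ⟨B.smul_mem _ hb, ?_⟩) <;> rw [← mul_smul, he]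
  rw [hinf, hsup, finrank_bot, add_zero]

theorem defect_of_isCompl [Module.Finite k M] {A B : Submodule (KroneckerAlgebra k) M}
    (h : IsCompl A B) : defect k M = defect k A + defect k B := by
  simp only [defect, finrank_cornerSpace_of_isCompl h e₁_mul_e₁,
    finrank_cornerSpace_of_isCompl h e₂_mul_e₂]
  push_cast
  ring

theorem isIndecomposable_congr {R : Type*} [Ring R] {M : Type v} {M' : Type w} [AddCommGroup M]
    [AddCommGroup M'] [Module R M] [Module R M'] (f : M ≃ₗ[R] M')
    (h : IsIndecomposable R M) : IsIndecomposable R M' := by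
  refine ⟨f.symm.toEquiv.nontrivial_congr.2 h.1, fun A B hAB => ?_⟩
  have := h.2 _ _ ((Submodule.orderIsoMapComap f.symm).isCompl hAB)
  simpa using this

theorem isIndecomposable_submodule_iff {R : Type*} [Ring R] {M : Type v} [AddCommGroup M]
    [Module R M] {N : Submodule R M} : IsIndecomposable R N ↔
      N ≠ ⊥ ∧ ∀ A B : Submodule R M, A ⊓ B = ⊥ → A ⊔ B = N → A = ⊥ ∨ B = ⊥ := by
  rw [IsIndecomposable, Submodule.nontrivial_iff_ne_bot]
  refine and_congr_right fun _ => ⟨fun h A B hi hs => ?_, fun h A B hAB => ?_⟩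
  · have hA : A ≤ N := hs ▸ le_sup_left
    have hB : B ≤ N := hs ▸ le_sup_right
    have hc : IsCompl (A.submoduleOf N) (B.submoduleOf N) := by
      refine ⟨?_, ?_⟩
      · rw [disjoint_iff, Submodule.submoduleOf, Submodule.submoduleOf, ← Submodule.comap_inf, hi,
          Submodule.comap_bot, Submodule.ker_subtype]
      · rw [codisjoint_iff, ← Submodule.submoduleOf_sup_of_le hA hB, hs,
          Submodule.submoduleOf_self]
    refine (h _ _ hc).imp (fun h' => ?_) (fun h' => ?_)
    · rw [← inf_eq_right.2 hA, ← Submodule.map_comap_subtype]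
      exact (congrArg _ h').trans (Submodule.map_bot _)
    · rw [← inf_eq_right.2 hB, ← Submodule.map_comap_subtype]
      exact (congrArg _ h').trans (Submodule.map_bot _)
  · have h' := h (A.map N.subtype) (B.map N.subtype)
      (by rw [← Submodule.map_inf _ N.subtype_injective, hAB.inf_eq_bot, Submodule.map_bot])
      (by rw [← Submodule.map_sup, hAB.sup_eq_top, Submodule.map_subtype_top])
    have inj := Submodule.map_injective_of_injective N.subtype_injective
    exact h'.imp (fun h => inj (h.trans (Submodule.map_bot _).symm))
      (fun h => inj (h.trans (Submodule.map_bot _).symm))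

theorem IsRegular.congr (f : M ≃ₗ[KroneckerAlgebra k] M') (h : IsRegular k M) :
    IsRegular k M' := by
  refine ⟨?_, fun A B hAB hA => ?_⟩
  · have := h.1
    exact Module.Finite.equiv (f.restrictScalars k)
  · let g := f.symm.submoduleMap A
    rw [defect_congr g]
    exact h.2 _ _ ((Submodule.orderIsoMapComap f.symm).isCompl hAB) (isIndecomposable_congr g hA)

theorem IsSimpleRegular.congr (f : M ≃ₗ[KroneckerAlgebra k] M') (h : IsSimpleRegular k M) :
    IsSimpleRegular k M' := by
  refine ⟨f.symm.toEquiv.nontrivial_congr.2 h.1, h.2.1.congr f, fun N hN => ?_⟩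
  have := h.2.2 _ (hN.congr (f.symm.submoduleMap N))
  refine this.imp (fun h => by simpa using h) fun h =>
    (_root_.map_eq_top_iff (Submodule.orderIsoMapComap f.symm)).1 h

/-- If `A = C ⊕ D` and `M = A ⊕ B`, then `C` is a summand of `M` with complement `D ⊔ B`. -/
theorem IsRegular.of_isCompl {A B : Submodule (KroneckerAlgebra k) M} (hAB : IsCompl A B)
    (h : IsRegular k M) : IsRegular k A := by
  have := h.1
  refine ⟨Module.Finite.of_injective (A.subtype.restrictScalars k) A.subtype_injective,
    fun C D hCD hC => ?_⟩
  let g := Submodule.equivMapOfInjective A.subtype A.subtype_injective C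
  rw [defect_congr g]
  refine h.2 _ (D.map A.subtype ⊔ B) ?_ (isIndecomposable_congr g hC)
  have h1 : C.map A.subtype ⊔ D.map A.subtype = A := by
    rw [← Submodule.map_sup, hCD.sup_eq_top, Submodule.map_subtype_top]
  have h2 : C.map A.subtype ⊓ D.map A.subtype = ⊥ := by
    rw [← Submodule.map_inf _ A.subtype_injective, hCD.inf_eq_bot, Submodule.map_bot]
  refine ⟨?_, ?_⟩
  · refine Disjoint.disjoint_sup_right_of_disjoint_sup_left (disjoint_iff.2 h2) ?_
    rw [h1]
    exact hAB.disjoint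
  · rw [codisjoint_iff, ← sup_assoc, h1, hAB.sup_eq_top]

/-- Induction on the dimension: a decomposable regular module splits into two smaller regular
summands, and the defect is additive. -/
theorem IsRegular.defect_eq_zero (h : IsRegular k M) : defect k M = 0 := by
  have := h.1
  induction hn : Module.finrank k M using Nat.strong_induction_on generalizing M with
  | _ n ih =>
    by_cases hind : IsIndecomposable (KroneckerAlgebra k) M
    · rw [← defect_congr (Submodule.topEquiv : (⊤ : Submodule (KroneckerAlgebra k) M) ≃ₗ[_] M)]
      exact h.2 ⊤ ⊥ isCompl_top_bot (isIndecomposable_congr Submodule.topEquiv.symm hind)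
    · rw [IsIndecomposable, not_and_or] at hind
      rcases hind with hind | hind
      · rw [not_nontrivial_iff_subsingleton] at hind
        rw [defect, Module.finrank_zero_of_subsingleton, Module.finrank_zero_of_subsingleton,
          sub_self]
      · push Not at hind
        obtain ⟨A, B, hAB, hA, hB⟩ := hind
        have hdim : Module.finrank k A + Module.finrank k B = Module.finrank k M := by
          have := (h.of_isCompl hAB).1
          have := (h.of_isCompl hAB.symm).1
          rw [← Module.finrank_prod]
          exact ((Submodule.prodEquivOfIsCompl A B hAB).restrictScalars k).finrank_eq
        have hA' : 0 < Module.finrank k A := by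
          have := (Submodule.nontrivial_iff_ne_bot).2 hA
          have : Module.Finite k A := (h.of_isCompl hAB).1
          exact Module.finrank_pos
        have hB' : 0 < Module.finrank k B := by
          have := (Submodule.nontrivial_iff_ne_bot).2 hB
          have : Module.Finite k B := (h.of_isCompl hAB.symm).1
          exact Module.finrank_pos
        rw [defect_of_isCompl hAB,
          ih _ (by omega) (h.of_isCompl hAB) (h.of_isCompl hAB).1 rfl,
          ih _ (by omega) (h.of_isCompl hAB.symm) (h.of_isCompl hAB.symm).1 rfl, add_zero]

theorem IsIndecomposable.isRegular [Module.Finite k M]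
    (h : IsIndecomposable (KroneckerAlgebra k) M) (h0 : defect k M = 0) : IsRegular k M := by
  refine ⟨‹_›, fun A B hAB hA => ?_⟩
  have hA' : A ≠ ⊥ := (Submodule.nontrivial_iff_ne_bot).1 hA.1
  have hB : B = ⊥ := (h.2 A B hAB).resolve_left hA'
  subst hB
  obtain rfl : A = ⊤ := by simpa using hAB.sup_eq_top
  rw [defect_congr Submodule.topEquiv, h0]

end Transport

/-! ### Representations attached to `k[X]`-modules -/

section PolyRep

/-- The polynomial by which one of the arrows acts: the first or the second arrow acts by `1`,
according to the value of the boolean, and the other one by `X`. -/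
noncomputable def coef (k : Type u) [Field k] (b : Bool) : k[X] := bif b then X else 1

/-- The arrow that acts by `1`. -/
def arrow (k : Type u) [Field k] (b : Bool) : KroneckerAlgebra k :=
  bif b then ⟨0, 0, 1, 0⟩ else ⟨0, 1, 0, 0⟩

variable (k : Type u) [Field k] (b : Bool) (P : Type v) [AddCommGroup P] [Module k P]
  [Module k[X] P] [IsScalarTower k k[X] P]

/-- The representation on two copies of a `k[X]`-module in which one arrow is the identity and the
other one is the multiplication by `X`. -/
abbrev PolyRep : Type v :=
  Rep (Algebra.lsmul k k P (coef k b)) (Algebra.lsmul k k P (coef k !b))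

variable {k b P}

namespace PolyRep

/-- The element of `PolyRep k b P` with given coordinates. -/
def mk (v w : P) : PolyRep k b P := ((v, w) : P × P)

@[simp] theorem mk_fst (v w : P) : (mk v w : PolyRep k b P).1 = v := rfl

@[simp] theorem mk_snd (v w : P) : (mk v w : PolyRep k b P).2 = w := rfl

theorem ext {m n : PolyRep k b P} (h₁ : m.1 = n.1) (h₂ : m.2 = n.2) : m = n := Prod.ext h₁ h₂

theorem arrow_smul (m : PolyRep k b P) : arrow k b • m = mk m.2 0 := by
  refine ext ?_ ?_ <;> cases b <;> simp [arrow, coef]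

theorem arrow_not_smul (m : PolyRep k b P) :
    arrow k (!b) • m = mk ((X : k[X]) • m.2) 0 := by
  refine ext ?_ ?_ <;> cases b <;> simp [arrow, coef]

theorem e₁_smul (m : PolyRep k b P) : e₁ k • m = mk m.1 0 := by
  refine ext ?_ ?_ <;> simp [e₁]

theorem e₂_smul (m : PolyRep k b P) : e₂ k • m = mk 0 m.2 := by
  refine ext ?_ ?_ <;> simp [e₂]

variable {P' : Type w} [AddCommGroup P'] [Module k P'] [Module k[X] P'] [IsScalarTower k k[X] P']

/-- `PolyRep` is a functor. -/
noncomputable def map (φ : P →ₗ[k[X]] P') :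
    PolyRep k b P →ₗ[KroneckerAlgebra k] PolyRep k b P' where
  toFun m := mk (φ m.1) (φ m.2)
  map_add' m n := ext (map_add φ _ _) (map_add φ _ _)
  map_smul' r m := by
    have h (t : k) (x : P) : φ (t • x) = t • φ x := LinearMap.map_smul_of_tower φ t x
    refine ext ?_ ?_ <;> simp [h]

@[simp] theorem map_fst (φ : P →ₗ[k[X]] P') (m : PolyRep k b P) : (map φ m).1 = φ m.1 := rfl

@[simp] theorem map_snd (φ : P →ₗ[k[X]] P') (m : PolyRep k b P) : (map φ m).2 = φ m.2 := rfl

/-- Functoriality of `PolyRep` for isomorphisms. -/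
noncomputable def mapEquiv (φ : P ≃ₗ[k[X]] P') :
    PolyRep k b P ≃ₗ[KroneckerAlgebra k] PolyRep k b P' where
  __ := map φ.toLinearMap
  invFun := map φ.symm.toLinearMap
  left_inv _ := ext (φ.symm_apply_apply _) (φ.symm_apply_apply _)
  right_inv _ := ext (φ.apply_symm_apply _) (φ.apply_symm_apply _)

/-- The submodule of a `PolyRep` given by a `k[X]`-submodule. -/
def sub (b : Bool) (Q : Submodule k[X] P) : Submodule (KroneckerAlgebra k) (PolyRep k b P) where
  carrier := {m | m.1 ∈ Q ∧ m.2 ∈ Q}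
  add_mem' h h' := ⟨Q.add_mem h.1 h'.1, Q.add_mem h.2 h'.2⟩
  zero_mem' := ⟨Q.zero_mem, Q.zero_mem⟩
  smul_mem' _ _ h :=
    ⟨Q.add_mem (Q.add_mem (Q.smul_of_tower_mem _ h.1)
      (Q.smul_of_tower_mem _ (Q.smul_mem _ h.2))) (Q.smul_of_tower_mem _ (Q.smul_mem _ h.2)),
      Q.smul_of_tower_mem _ h.2⟩

theorem sub_le_sub_iff {Q Q' : Submodule k[X] P} : sub b Q ≤ sub b Q' ↔ Q ≤ Q' :=
  ⟨fun h x hx => (h (show mk x 0 ∈ sub b Q from ⟨hx, Q.zero_mem⟩)).1,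
    fun h _ hm => ⟨h hm.1, h hm.2⟩⟩

theorem sub_injective : Function.Injective (sub b : Submodule k[X] P → _) := fun _ _ h =>
  le_antisymm (sub_le_sub_iff.1 h.le) (sub_le_sub_iff.1 h.ge)

@[simp] theorem sub_bot : sub b (⊥ : Submodule k[X] P) = ⊥ := by
  rw [eq_bot_iff]
  exact fun m hm => ext hm.1 hm.2

@[simp] theorem sub_top : sub b (⊤ : Submodule k[X] P) = ⊤ := by
  rw [eq_top_iff]
  exact fun m _ => ⟨trivial, trivial⟩

theorem sub_inf (Q Q' : Submodule k[X] P) : sub b (Q ⊓ Q') = sub b Q ⊓ sub b Q' := by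
  ext m
  exact and_and_and_comm

theorem sub_sup (Q Q' : Submodule k[X] P) : sub b (Q ⊔ Q') = sub b Q ⊔ sub b Q' := by
  refine le_antisymm ?_ (sup_le (sub_le_sub_iff.2 le_sup_left) (sub_le_sub_iff.2 le_sup_right))
  rintro m ⟨h₁, h₂⟩
  obtain ⟨x₁, hx₁, y₁, hy₁, h₁⟩ := Submodule.mem_sup.1 h₁
  obtain ⟨x₂, hx₂, y₂, hy₂, h₂⟩ := Submodule.mem_sup.1 h₂
  exact Submodule.mem_sup.2 ⟨mk x₁ x₂, ⟨hx₁, hx₂⟩, mk y₁ y₂, ⟨hy₁, hy₂⟩, ext h₁ h₂⟩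

theorem ker_map (φ : P →ₗ[k[X]] P') :
    LinearMap.ker (map φ : PolyRep k b P →ₗ[KroneckerAlgebra k] _) = sub b (LinearMap.ker φ) := by
  ext m
  exact ⟨fun h => ⟨congrArg Prod.fst h, congrArg Prod.snd h⟩, fun h => ext h.1 h.2⟩

theorem map_sub_map (φ : P →ₗ[k[X]] P') (Q : Submodule k[X] P) :
    (sub b Q).map (map φ) = sub b (Q.map φ) := by
  ext m
  constructor
  · rintro ⟨n, hn, rfl⟩
    exact ⟨⟨_, hn.1, rfl⟩, ⟨_, hn.2, rfl⟩⟩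
  · rintro ⟨⟨x, hx, h₁⟩, ⟨y, hy, h₂⟩⟩
    exact ⟨mk x y, ⟨hx, hy⟩, ext h₁ h₂⟩

/-- `sub b Q` is `PolyRep` of `Q`. -/
noncomputable def subEquiv (b : Bool) (Q : Submodule k[X] P) :
    PolyRep k b Q ≃ₗ[KroneckerAlgebra k] sub b Q :=
  (LinearEquiv.ofInjective (map Q.subtype) fun m n h =>
      ext (Subtype.ext (congrArg Prod.fst h)) (Subtype.ext (congrArg Prod.snd h))).trans
    (LinearEquiv.ofEq _ _ (by
      rw [LinearMap.range_eq_map, ← sub_top, map_sub_map, Submodule.map_subtype_top]))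

/-- The idempotents split `Φ` into two components, the identity arrow forces these to coincide, and
the other arrow makes the common map commute with `X`. -/
theorem exists_map_eq (Φ : PolyRep k b P →ₗ[KroneckerAlgebra k] PolyRep k b P') :
    ∃ φ, map φ = Φ := by
  have h1 (x : P) : Φ (mk x 0) = mk (Φ (mk x 0)).1 0 := by
    rw [← e₁_smul, ← map_smul, e₁_smul, mk_fst]
  have h2 (x : P) : Φ (mk 0 x) = mk 0 (Φ (mk 0 x)).2 := by
    rw [← e₂_smul, ← map_smul, e₂_smul, mk_snd]
  have h3 (x : P) : (Φ (mk x 0)).1 = (Φ (mk 0 x)).2 := by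
    have := Φ.map_smul (arrow k b) (mk 0 x)
    rw [arrow_smul, arrow_smul] at this
    exact congrArg Prod.fst this
  have hX (x : P) : (Φ (mk ((X : k[X]) • x) 0)).1 = (X : k[X]) • (Φ (mk x 0)).1 := by
    have := Φ.map_smul (arrow k !b) (mk 0 x)
    rw [arrow_not_smul, arrow_not_smul] at this
    rw [h3 x]
    exact congrArg Prod.fst this
  have hadd (x y : P) : (Φ (mk (x + y) 0)).1 = (Φ (mk x 0)).1 + (Φ (mk y 0)).1 := by
    rw [← Rep.add_fst, ← map_add]
    congr 2
    exact ext rfl (add_zero _).symm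
  have hC (t : k) (x : P) : (Φ (mk (t • x) 0)).1 = t • (Φ (mk x 0)).1 := by
    rw [← Rep.field_smul_fst, ← LinearMap.map_smul_of_tower]
    congr 2
    exact ext rfl (smul_zero _).symm
  have hpoly (f : k[X]) (x : P) : (Φ (mk (f • x) 0)).1 = f • (Φ (mk x 0)).1 := by
    induction f using Polynomial.induction_on generalizing x with
    | C a => rw [← Polynomial.algebraMap_eq, algebraMap_smul, algebraMap_smul, hC]
    | add f g hf hg => rw [add_smul, hadd, hf, hg, add_smul]
    | monomial n a ih => rw [pow_succ, ← mul_assoc, mul_smul, ih, hX, ← mul_smul]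
  refine ⟨⟨⟨fun x => (Φ (mk x 0)).1, hadd⟩, hpoly⟩, ?_⟩
  ext m
  have hm : m = mk m.1 0 + mk 0 m.2 := ext (add_zero _).symm (zero_add _).symm
  conv_rhs => rw [hm, map_add, h1, h2, ← h3]
  exact ext (add_zero _).symm (zero_add _).symm

/-- The endomorphism ring of `PolyRep k b P` is that of the `k[X]`-module `P`. -/
theorem nonempty_end_ringEquiv (b : Bool) (P : Type v) [AddCommGroup P] [Module k P]
    [Module k[X] P] [IsScalarTower k k[X] P] :
    Nonempty (Module.End (KroneckerAlgebra k) (PolyRep k b P) ≃+* Module.End k[X] P) := by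
  let F : Module.End k[X] P →+* Module.End (KroneckerAlgebra k) (PolyRep k b P) :=
    { toFun := map
      map_one' := rfl
      map_mul' := fun _ _ => rfl
      map_zero' := rfl
      map_add' := fun _ _ => rfl }
  refine ⟨(RingEquiv.ofBijective F ⟨?_, ?_⟩).symm⟩
  · intro φ ψ h
    ext x
    exact congrArg Prod.fst (LinearMap.congr_fun h (mk x 0))
  · exact exists_map_eq

/-- The inclusion of the first component. -/
def inl (k : Type u) [Field k] (b : Bool) (P : Type v) [AddCommGroup P] [Module k P]
    [Module k[X] P] [IsScalarTower k k[X] P] : P →ₗ[k] PolyRep k b P where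
  toFun x := mk x 0
  map_add' _ _ := ext rfl (add_zero _).symm
  map_smul' _ _ := ext rfl (smul_zero _).symm

/-- The inclusion of the second component. -/
def inr (k : Type u) [Field k] (b : Bool) (P : Type v) [AddCommGroup P] [Module k P]
    [Module k[X] P] [IsScalarTower k k[X] P] : P →ₗ[k] PolyRep k b P where
  toFun x := mk 0 x
  map_add' _ _ := ext (add_zero _).symm rfl
  map_smul' _ _ := ext (smul_zero _).symm rfl

theorem inl_injective : Function.Injective (inl k b P) := fun _ _ h => congrArg Prod.fst h

theorem inr_injective : Function.Injective (inr k b P) := fun _ _ h => congrArg Prod.snd h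

variable (N : Submodule (KroneckerAlgebra k) (PolyRep k b P))

theorem finrank_corner_e₁ : Module.finrank k (cornerSpace k N (e₁ k)) =
    Module.finrank k ((N.restrictScalars k).comap (inl k b P)) := by
  rw [← finrank_subCorner,
    (Submodule.equivMapOfInjective (inl k b P) inl_injective _).finrank_eq]
  suffices h : subCorner N (e₁ k) = ((N.restrictScalars k).comap (inl k b P)).map (inl k b P) by
    rw [h]
  ext m
  rw [mem_subCorner e₁_mul_e₁, e₁_smul]
  constructor
  · rintro ⟨h, h'⟩
    rw [← h'] at h ⊢
    exact ⟨_, h, rfl⟩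
  · rintro ⟨x, hx, rfl⟩
    exact ⟨hx, rfl⟩

theorem finrank_corner_e₂ : Module.finrank k (cornerSpace k N (e₂ k)) =
    Module.finrank k ((N.restrictScalars k).comap (inr k b P)) := by
  rw [← finrank_subCorner,
    (Submodule.equivMapOfInjective (inr k b P) inr_injective _).finrank_eq]
  suffices h : subCorner N (e₂ k) = ((N.restrictScalars k).comap (inr k b P)).map (inr k b P) by
    rw [h]
  ext m
  rw [mem_subCorner e₂_mul_e₂, e₂_smul]
  constructor
  · rintro ⟨h, h'⟩
    rw [← h'] at h ⊢
    exact ⟨_, h, rfl⟩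
  · rintro ⟨x, hx, rfl⟩
    exact ⟨hx, rfl⟩

theorem comap_inr_le : (N.restrictScalars k).comap (inr k b P) ≤
    (N.restrictScalars k).comap (inl k b P) := by
  intro x hx
  have := N.smul_mem (arrow k b) hx
  rwa [arrow_smul] at this

instance [Module.Finite k N] : Module.Finite k ((N.restrictScalars k).comap (inl k b P)) := by
  let f : (N.restrictScalars k).comap (inl k b P) →ₗ[k] N :=
    (inl k b P).restrict (p := (N.restrictScalars k).comap (inl k b P))
      (q := N.restrictScalars k) fun _ h => h
  exact Module.Finite.of_injective f fun x y h =>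
    Subtype.ext (inl_injective (congrArg Subtype.val h))

theorem defect_nonpos [Module.Finite k N] : defect k N ≤ 0 := by
  rw [defect, finrank_corner_e₁, finrank_corner_e₂, sub_nonpos]
  exact_mod_cast Submodule.finrank_mono (comap_inr_le N)

/-- Defect zero turns the inclusion `comap_inr_le` into an equality by dimension count; stability
under the other arrow then makes the common subspace a `k[X]`-submodule. -/
theorem exists_eq_sub [Module.Finite k N] (h : defect k N = 0) : ∃ Q, N = sub b Q := by
  rw [defect, finrank_corner_e₁, finrank_corner_e₂, sub_eq_zero] at h
  have heq := Submodule.eq_of_le_of_finrank_eq (comap_inr_le N) (by exact_mod_cast h)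
  have hiff (x : P) : mk 0 x ∈ N ↔ mk x 0 ∈ N := SetLike.ext_iff.1 heq x
  have hX (x : P) (hx : mk x 0 ∈ N) : mk ((X : k[X]) • x) 0 ∈ N := by
    have := N.smul_mem (arrow k !b) ((hiff x).2 hx)
    rwa [arrow_not_smul] at this
  let N₁ := (N.restrictScalars k).comap (inl k b P)
  have hpoly (f : k[X]) (x : P) (hx : x ∈ N₁) : f • x ∈ N₁ := by
    induction f using Polynomial.induction_on generalizing x with
    | C a => rw [← Polynomial.algebraMap_eq, algebraMap_smul]; exact N₁.smul_mem a hx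
    | add f g hf hg => rw [add_smul]; exact N₁.add_mem (hf x hx) (hg x hx)
    | monomial n a ih => rw [pow_succ, ← mul_assoc, mul_smul]; exact ih _ (hX x hx)
  refine ⟨⟨N₁.toAddSubmonoid, fun f x hx => hpoly f x hx⟩, ?_⟩
  ext m
  constructor
  · intro hm
    refine ⟨?_, (hiff _).1 ?_⟩
    · have := N.smul_mem (e₁ k) hm
      rwa [e₁_smul] at this
    · have := N.smul_mem (e₂ k) hm
      rwa [e₂_smul] at this
  · rintro ⟨h₁, h₂⟩
    have := N.add_mem (show mk m.1 0 ∈ N from h₁) ((hiff m.2).2 h₂)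
    convert this
    exact ext (add_zero _).symm (zero_add _).symm

theorem defect_eq_zero : defect k (PolyRep k b P) = 0 := by
  rw [← defect_congr (Submodule.topEquiv :
      (⊤ : Submodule (KroneckerAlgebra k) (PolyRep k b P)) ≃ₗ[_] _),
    defect, finrank_corner_e₁, finrank_corner_e₂, sub_eq_zero]
  rfl

instance [Module.Finite k P] : Module.Finite k (PolyRep k b P) :=
  inferInstanceAs (Module.Finite k (P × P))

/-- The defects of two complementary summands are nonpositive with sum zero, so both vanish and both
summands come from `k[X]`-submodules. -/
theorem isIndecomposable [Nontrivial P] [Module.Finite k P]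
    (h : ∀ A B : Submodule k[X] P, A ⊓ B = ⊥ → A = ⊥ ∨ B = ⊥) :
    IsIndecomposable (KroneckerAlgebra k) (PolyRep k b P) := by
  refine ⟨inferInstanceAs (Nontrivial (P × P)), fun A B hAB => ?_⟩
  have hfin (N : Submodule (KroneckerAlgebra k) (PolyRep k b P)) : Module.Finite k N :=
    Module.Finite.of_injective (N.subtype.restrictScalars k) N.subtype_injective
  have hsum := defect_of_isCompl hAB
  rw [defect_eq_zero] at hsum
  have := defect_nonpos A
  have := defect_nonpos B
  obtain ⟨Q, rfl⟩ := exists_eq_sub A (by omega)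
  obtain ⟨Q', rfl⟩ := exists_eq_sub B (by omega)
  have hi := hAB.inf_eq_bot
  rw [← sub_inf, ← sub_bot] at hi
  refine (h Q Q' (sub_injective hi)).imp ?_ ?_ <;> rintro rfl <;> exact sub_bot

theorem isSimpleRegular (b : Bool) (P : Type v) [AddCommGroup P] [Module k P] [Module k[X] P]
    [IsScalarTower k k[X] P] [Module.Finite k P] [IsSimpleModule k[X] P] :
    IsSimpleRegular k (PolyRep k b P) := by
  have := IsSimpleModule.nontrivial k[X] P
  refine ⟨inferInstanceAs (Nontrivial (P × P)), (isIndecomposable ?_).isRegular defect_eq_zero,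
    fun N hN => ?_⟩
  · intro A B h
    rcases eq_bot_or_eq_top A with rfl | rfl
    · exact Or.inl rfl
    · exact Or.inr (by simpa using h)
  · have := hN.1
    obtain ⟨Q, rfl⟩ := exists_eq_sub N hN.defect_eq_zero
    refine (eq_bot_or_eq_top Q).imp ?_ ?_ <;> rintro rfl
    exacts [sub_bot, sub_top]

end PolyRep

end PolyRep

end KroneckerAlgebra

/-! ### Primary modules with simple socle -/

section ResidueField

variable {S P : Type*} [CommRing S] [AddCommGroup P] [Module S P] {p : S} {v : P}
  [hp : (Ideal.span {p}).IsMaximal]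

/-- Since `f` does not kill `v`, it is invertible modulo `p`, and an inverse carries `f • v` back to
`v`. -/
theorem mem_span_smul_of_isMaximal (hv : p • v = 0) {f : S} (hf : f • v ≠ 0) :
    v ∈ Submodule.span S {f • v} := by
  have hfp : f ∉ Ideal.span {p} := by
    intro hmem
    obtain ⟨c, rfl⟩ := Ideal.mem_span_singleton'.1 hmem
    exact hf (by rw [mul_smul, hv, smul_zero])
  obtain ⟨y, i, hi, hy⟩ := hp.exists_inv hfp
  obtain ⟨c, rfl⟩ := Ideal.mem_span_singleton'.1 hi
  refine Submodule.mem_span_singleton.2 ⟨y, ?_⟩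
  have := congrArg (· • v) hy
  simpa [add_smul, mul_smul, hv] using this

theorem torsionOf_eq_span (hv0 : v ≠ 0) (hv : p • v = 0) :
    Ideal.torsionOf S P v = Ideal.span {p} := by
  refine (hp.eq_of_le ?_ ?_).symm
  · rw [Ne, Ideal.torsionOf_eq_top_iff]
    exact hv0
  · rw [Ideal.span_le, Set.singleton_subset_iff]
    exact hv

/-- The submodule generated by a nonzero element killed by `p` is the residue field. -/
noncomputable def quotEquivSpanSingleton (hv0 : v ≠ 0) (hv : p • v = 0) :
    (S ⧸ Ideal.span {p}) ≃ₗ[S] Submodule.span S {v} :=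
  (Submodule.quotEquivOfEq _ _ (torsionOf_eq_span hv0 hv).symm).trans
    (Ideal.quotTorsionOfEquivSpanSingleton S P v)

end ResidueField

/-- `P` is a `p`-primary module over `S` whose `p`-torsion is cyclic, generated by `v ≠ 0`. -/
structure IsUniserialAt {S P : Type*} [CommRing S] [AddCommGroup P] [Module S P] (p : S) (v : P) :
    Prop where
  torsion : ∀ m : P, ∃ n : ℕ, p ^ n • m = 0
  ne_zero : v ≠ 0
  smul_eq_zero : p • v = 0
  mem_span : ∀ w : P, p • w = 0 → w ∈ Submodule.span S {v}

namespace IsUniserialAt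

section General

variable {S P : Type*} [CommRing S] [AddCommGroup P] [Module S P] {p : S} {v : P}

/-- Induction on `j`: `p ^ j • u` lies in the socle, so it is a multiple of `v = p ^ n • w`;
subtracting a suitable multiple of `w` from `u` lowers the exponent that kills it. -/
theorem mem_span_of_pow_smul (h : IsUniserialAt p v) {w : P} {n : ℕ} (hw : p ^ n • w = v) {j : ℕ}
    (hj : j ≤ n) {u : P} (hu : p ^ (j + 1) • u = 0) : u ∈ Submodule.span S {w} := by
  induction j generalizing u with
  | zero =>
    rw [zero_add, pow_one] at hu
    refine (Submodule.span_singleton_le_iff_mem _ _).2 ?_ (h.mem_span u hu)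
    rw [← hw]
    exact Submodule.smul_mem _ _ (Submodule.mem_span_singleton_self w)
  | succ j ih =>
    have h1 : p • p ^ (j + 1) • u = 0 := by rw [← mul_smul, ← pow_succ', hu]
    obtain ⟨f, hf⟩ := Submodule.mem_span_singleton.1 (h.mem_span _ h1)
    have h2 : p ^ (j + 1) • (u - (f * p ^ (n - (j + 1))) • w) = 0 := by
      rw [smul_sub, ← hf, ← hw, ← mul_smul, ← mul_smul, sub_eq_zero]
      congr 1
      rw [mul_left_comm, ← pow_add, Nat.add_sub_cancel' hj]
    have h3 := ih (by omega) h2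
    have := Submodule.add_mem _ h3
      (Submodule.smul_mem _ (f * p ^ (n - (j + 1))) (Submodule.mem_span_singleton_self w))
    rwa [sub_add_cancel] at this

theorem exists_pow_smul_mem_span (h : IsUniserialAt p v) {u : P} (hu : u ≠ 0) :
    ∃ n : ℕ, p ^ n • u ≠ 0 ∧ p ^ (n + 1) • u = 0 := by
  classical
  have hn := Nat.find_spec (h.torsion u)
  have h0 : Nat.find (h.torsion u) ≠ 0 := fun h0 => hu (by rwa [h0, pow_zero, one_smul] at hn)
  refine ⟨Nat.find (h.torsion u) - 1, Nat.find_min (h.torsion u) (by omega), ?_⟩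
  rwa [Nat.sub_add_cancel (by omega)]

theorem torsionBy_eq_span (h : IsUniserialAt p v) :
    Submodule.torsionBy S P p = Submodule.span S {v} := by
  refine le_antisymm (fun w hw => h.mem_span w hw) ?_
  rw [Submodule.span_singleton_le_iff_mem]
  exact h.smul_eq_zero

variable [hp : (Ideal.span {p}).IsMaximal]

/-- The socle is essential: the last nonzero `p ^ n • u` is a multiple `f • v` with `f` invertible
modulo `p`. -/
theorem mem_of_ne_bot (h : IsUniserialAt p v) {Q : Submodule S P} (hQ : Q ≠ ⊥) : v ∈ Q := by
  obtain ⟨u, hu, hu0⟩ := (Submodule.ne_bot_iff Q).1 hQ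
  obtain ⟨n, hn, hn'⟩ := h.exists_pow_smul_mem_span hu0
  rw [pow_succ', mul_smul] at hn'
  obtain ⟨f, hf⟩ := Submodule.mem_span_singleton.1 (h.mem_span _ hn')
  rw [← hf] at hn
  refine (Submodule.span_singleton_le_iff_mem _ _).2 ?_ (mem_span_smul_of_isMaximal h.smul_eq_zero hn)
  rw [hf]
  exact Q.smul_mem _ hu

/-- Normalizes the generator of a cyclic submodule by a unit modulo `p`, so that `n + 1` measures
its length. -/
theorem exists_pow_smul_eq (h : IsUniserialAt p v) {u : P} (hu : u ≠ 0) :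
    ∃ (n : ℕ) (w : P), p ^ n • w = v ∧ Submodule.span S {w} = Submodule.span S {u} := by
  obtain ⟨n, hn, hn'⟩ := h.exists_pow_smul_mem_span hu
  have hn'' := hn'
  rw [pow_succ', mul_smul] at hn''
  obtain ⟨f, hf⟩ := Submodule.mem_span_singleton.1 (h.mem_span _ hn'')
  rw [← hf] at hn
  obtain ⟨g, hg⟩ := Submodule.mem_span_singleton.1 (mem_span_smul_of_isMaximal h.smul_eq_zero hn)
  have hw : p ^ n • g • u = v := by rw [smul_comm, ← hf, hg]
  refine ⟨n, g • u, hw, le_antisymm ?_ ?_⟩ <;> rw [Submodule.span_singleton_le_iff_mem]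
  · exact Submodule.smul_mem _ _ (Submodule.mem_span_singleton_self u)
  · exact h.mem_span_of_pow_smul hw le_rfl hn'

/-- A `p`-primary module with cyclic `p`-torsion is cyclic or `p`-divisible. -/
theorem exists_span_eq_top_or (h : IsUniserialAt p v) :
    (∃ w : P, Submodule.span S {w} = ⊤) ∨ ∀ m : P, ∃ m', p • m' = m := by
  rw [or_iff_not_imp_right]
  intro hnot
  push Not at hnot
  obtain ⟨m, hm⟩ := hnot
  have hm0 : m ≠ 0 := fun h0 => hm 0 (by rw [smul_zero, h0])
  obtain ⟨a, w, hw, hwm⟩ := h.exists_pow_smul_eq hm0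
  refine ⟨m, ?_⟩
  rw [eq_top_iff]
  intro u _
  by_cases hu0 : u = 0
  · rw [hu0]; exact Submodule.zero_mem _
  obtain ⟨c, y, hy, hyu⟩ := h.exists_pow_smul_eq hu0
  have hu : u ∈ Submodule.span S {y} := by rw [hyu]; exact Submodule.mem_span_singleton_self u
  have hmw : m ∈ Submodule.span S {w} := by rw [hwm]; exact Submodule.mem_span_singleton_self m
  have kill {j : ℕ} {z z' : P} (hz : p ^ j • z = v) (hz' : z' ∈ Submodule.span S {z}) :
      p ^ (j + 1) • z' = 0 := by
    obtain ⟨f, rfl⟩ := Submodule.mem_span_singleton.1 hz'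
    rw [smul_comm, pow_succ', mul_smul, hz, h.smul_eq_zero, smul_zero]
  -- The cyclic submodules of `u` and `m` are compared by length. If that of `u` is not longer, it
  -- lies in that of `m`; otherwise `m` is a multiple of `p ^ (c - a) • y` with `c > a`,
  -- contradicting that `m` is not divisible by `p`.
  rcases le_or_gt c a with hca | hac
  · rw [← hwm]
    exact h.mem_span_of_pow_smul hw hca (kill hy hu)
  · have h1 : p ^ a • p ^ (c - a) • y = v := by
      rw [← mul_smul, ← pow_add, Nat.add_sub_cancel' hac.le, hy]
    obtain ⟨f, hf⟩ := Submodule.mem_span_singleton.1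
      (h.mem_span_of_pow_smul h1 le_rfl (kill hw hmw))
    refine absurd ?_ (hm (f • p ^ (c - a - 1) • y))
    rw [← hf, smul_comm, ← mul_smul p, ← pow_succ', Nat.sub_add_cancel (by omega)]

end General

end IsUniserialAt

section Finite

variable {k : Type u} [Field k]

theorem finite_quotient_span_singleton {f : k[X]} (hf : f ≠ 0) :
    Module.Finite k (k[X] ⧸ Ideal.span {f}) :=
  (AdjoinRoot.powerBasis hf).finite

theorem finite_span_singleton {P : Type v} [AddCommGroup P] [Module k P] [Module k[X] P]
    [IsScalarTower k k[X] P] {f : k[X]} (hf : f ≠ 0) {w : P} (hw : f • w = 0) :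
    Module.Finite k (Submodule.span k[X] {w}) := by
  have := finite_quotient_span_singleton hf
  have hle : Ideal.span {f} ≤ LinearMap.ker (LinearMap.toSpanSingleton k[X] P w) := by
    rw [Ideal.span_le, Set.singleton_subset_iff]
    exact hw
  let g := Submodule.liftQ (Ideal.span {f}) (LinearMap.toSpanSingleton k[X] P w) hle
  have hg : LinearMap.range g = Submodule.span k[X] {w} := by
    rw [Submodule.range_liftQ, LinearMap.range_toSpanSingleton]
  rw [← hg]
  exact Module.Finite.of_surjective (g.rangeRestrict.restrictScalars k) g.surjective_rangeRestrict

end Finite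

/-! ### Existence of Prüfer modules -/

namespace KroneckerAlgebra

section Existence

variable {k : Type u} [Field k] {b : Bool} {P : Type v} [AddCommGroup P] [Module k P]
  [Module k[X] P] [IsScalarTower k k[X] P] {p : k[X]} {v : P}

theorem isSimpleModule_quotient [hp : (Ideal.span {p}).IsMaximal] :
    IsSimpleModule k[X] (k[X] ⧸ Ideal.span {p}) :=
  isSimpleModule_iff_quot_maximal.2 ⟨_, hp, ⟨LinearEquiv.refl _ _⟩⟩

theorem isSimpleRegular_quotient [hp : (Ideal.span {p}).IsMaximal] (hp0 : p ≠ 0) (b : Bool) :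
    IsSimpleRegular k (PolyRep k b (k[X] ⧸ Ideal.span {p})) := by
  have := finite_quotient_span_singleton hp0
  have := isSimpleModule_quotient (p := p)
  exact PolyRep.isSimpleRegular b _

/-- Divisibility gives `w` with `p ^ n • w = v`; the `p ^ n`-torsion lies in the cyclic module of
`w`, which is killed by `p ^ (n + 1)`. -/
theorem finite_torsionBy (h : IsUniserialAt p v) (hp0 : p ≠ 0)
    (hsurj : ∀ m : P, ∃ m', p • m' = m) (n : ℕ) :
    Module.Finite k (Submodule.torsionBy k[X] P (p ^ n)) := by
  obtain ⟨w, hw⟩ := (Function.Surjective.iterate (f := fun m : P => p • m) hsurj n) v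
  replace hw : p ^ n • w = v := by rwa [smul_iterate] at hw
  have hfin := finite_span_singleton (k := k) (f := p ^ (n + 1)) (pow_ne_zero _ hp0) (w := w)
    (by rw [pow_succ', mul_smul, hw, h.smul_eq_zero])
  have hle : Submodule.torsionBy k[X] P (p ^ n) ≤ Submodule.span k[X] {w} := by
    intro u hu
    refine h.mem_span_of_pow_smul hw le_rfl ?_
    rw [Submodule.mem_torsionBy_iff] at hu
    rw [pow_succ', mul_smul, hu, smul_zero]
  exact Module.Finite.of_injective ((Submodule.inclusion hle).restrictScalars k)
    (Submodule.inclusion_injective hle)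

variable [hp : (Ideal.span {p}).IsMaximal]

/-- The submodule given by a nonzero element killed by `p`. -/
noncomputable def subSpanEquiv (hv0 : v ≠ 0) (hv : p • v = 0) (b : Bool) :
    PolyRep k b (k[X] ⧸ Ideal.span {p}) ≃ₗ[KroneckerAlgebra k]
      PolyRep.sub b (Submodule.span k[X] {v}) :=
  (PolyRep.mapEquiv (quotEquivSpanSingleton hv0 hv)).trans (PolyRep.subEquiv b _)

theorem isSimpleRegular_sub_span (hv0 : v ≠ 0) (hv : p • v = 0) (hp0 : p ≠ 0) (b : Bool) :
    IsSimpleRegular k (PolyRep.sub b (Submodule.span k[X] {v})) :=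
  (isSimpleRegular_quotient hp0 b).congr (subSpanEquiv hv0 hv b)

/-- `N` has defect zero, so it comes from a nonzero `Q`, which contains `v`; the regular submodule
given by `v` must then be all of `N`. -/
theorem eq_sub_span_of_isSimpleRegular (h : IsUniserialAt p v) (hp0 : p ≠ 0)
    {N : Submodule (KroneckerAlgebra k) (PolyRep k b P)} (hN : IsSimpleRegular k N) :
    N = PolyRep.sub b (Submodule.span k[X] {v}) := by
  have := hN.2.1.1
  obtain ⟨Q, rfl⟩ := PolyRep.exists_eq_sub N hN.2.1.defect_eq_zero
  have hQ : Q ≠ ⊥ := by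
    rintro rfl
    exact (Submodule.nontrivial_iff_ne_bot.1 hN.1) PolyRep.sub_bot
  have hle : PolyRep.sub b (Submodule.span k[X] {v}) ≤ PolyRep.sub b Q :=
    PolyRep.sub_le_sub_iff.2 ((Submodule.span_singleton_le_iff_mem _ _).2 (h.mem_of_ne_bot hQ))
  have hreg := (isSimpleRegular_sub_span h.ne_zero h.smul_eq_zero hp0 b).2.1.congr
    (Submodule.submoduleOfEquivOfLe hle).symm
  refine le_antisymm ?_ hle
  rcases hN.2.2 _ hreg with h0 | h0
  · exfalso
    have hv : PolyRep.mk v 0 ∈ PolyRep.sub b (Submodule.span k[X] {v}) :=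
      ⟨Submodule.mem_span_singleton_self v, Submodule.zero_mem _⟩
    have : (⟨PolyRep.mk v 0, hle hv⟩ : PolyRep.sub b Q) = 0 := by
      rw [← Submodule.mem_bot (KroneckerAlgebra k), ← h0]
      exact hv
    exact h.ne_zero (congrArg Prod.fst (congrArg Subtype.val this))
  · exact Submodule.submoduleOf_eq_top.1 h0

/-- Two nonzero `k[X]`-submodules both contain `v`, so they cannot be independent. -/
theorem isIndecomposable_sub (h : IsUniserialAt p v) {Q : Submodule k[X] P} (hQ : Q ≠ ⊥)
    [Module.Finite k Q] : IsIndecomposable (KroneckerAlgebra k) (PolyRep.sub b Q) := by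
  have := (Submodule.nontrivial_iff_ne_bot).2 hQ
  refine isIndecomposable_congr (PolyRep.subEquiv b Q) (PolyRep.isIndecomposable fun A B hAB => ?_)
  by_contra hne
  rw [not_or] at hne
  have inj := Submodule.map_injective_of_injective Q.subtype_injective
  have hA := h.mem_of_ne_bot (Q := A.map Q.subtype)
    (fun h0 => hne.1 (inj (h0.trans (Submodule.map_bot _).symm)))
  have hB := h.mem_of_ne_bot (Q := B.map Q.subtype)
    (fun h0 => hne.2 (inj (h0.trans (Submodule.map_bot _).symm)))
  have := Submodule.mem_inf.2 ⟨hA, hB⟩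
  rw [← Submodule.map_inf _ Q.subtype_injective, hAB, Submodule.map_bot, Submodule.mem_bot] at this
  exact h.ne_zero this

theorem regularSocle_sub (h : IsUniserialAt p v) (hp0 : p ≠ 0) {Q : Submodule k[X] P}
    (hv : v ∈ Q) : regularSocle k (PolyRep.sub b Q) =
      (PolyRep.sub b (Submodule.span k[X] {v})).submoduleOf (PolyRep.sub b Q) := by
  have hle : PolyRep.sub b (Submodule.span k[X] {v}) ≤ PolyRep.sub b Q :=
    PolyRep.sub_le_sub_iff.2 ((Submodule.span_singleton_le_iff_mem _ _).2 hv)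
  rw [regularSocle]
  refine (congrArg sSup (Set.ext fun N => ?_)).trans sSup_singleton
  rw [Set.mem_singleton_iff, Set.mem_ofPred_eq]
  constructor
  · intro hN
    have := eq_sub_span_of_isSimpleRegular h hp0 (hN.congr
      (Submodule.equivMapOfInjective _ (PolyRep.sub b Q).subtype_injective N))
    rw [← this, Submodule.submoduleOf,
      Submodule.comap_map_eq_of_injective (Submodule.subtype_injective _)]
  · rintro rfl
    exact (isSimpleRegular_sub_span h.ne_zero h.smul_eq_zero hp0 b).congr
      (Submodule.submoduleOfEquivOfLe hle).symm

/-- By divisibility, multiplication by `p ^ i` maps the `p ^ (i + 1)`-torsion onto the `p`-torsion,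
with kernel the `p ^ i`-torsion; so all factors of the torsion filtration are the simple regular
socle. -/
theorem hasRegularLength_sub (h : IsUniserialAt p v) (hp0 : p ≠ 0)
    (hsurj : ∀ m : P, ∃ m', p • m' = m) (n : ℕ) :
    HasRegularLength k (PolyRep.sub b (Submodule.torsionBy k[X] P (p ^ n))) n := by
  have hmono {i j : ℕ} (hij : i ≤ j) :
      Submodule.torsionBy k[X] P (p ^ i) ≤ Submodule.torsionBy k[X] P (p ^ j) :=
    Submodule.torsionBy_le_torsionBy_of_dvd _ _ (pow_dvd_pow p hij)
  let c : ℕ → Submodule (KroneckerAlgebra k) (PolyRep k b P) :=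
    fun i => PolyRep.sub b (Submodule.torsionBy k[X] P (p ^ i))
  refine ⟨fun i => (c i).submoduleOf (c n), ?_, Submodule.submoduleOf_self _, fun i hi => ⟨?_, ?_⟩⟩
  · simp [c, Submodule.submoduleOf]
  · exact Submodule.comap_mono (PolyRep.sub_le_sub_iff.2 (hmono (Nat.le_succ i)))
  · let φ : P →ₗ[k[X]] P := algebraMap k[X] (Module.End k[X] P) (p ^ i)
    let g := (PolyRep.map φ : PolyRep k b P →ₗ[KroneckerAlgebra k] _) ∘ₗ (c n).subtype ∘ₗ
      ((c (i + 1)).submoduleOf (c n)).subtype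
    have hker : LinearMap.ker g =
        ((c i).submoduleOf (c n)).submoduleOf ((c (i + 1)).submoduleOf (c n)) := by
      rw [LinearMap.ker_comp, PolyRep.ker_map]
      rfl
    have hrange : LinearMap.range g = PolyRep.sub b (Submodule.span k[X] {v}) := by
      have hcc : c (i + 1) ≤ c n := PolyRep.sub_le_sub_iff.2 (hmono hi)
      rw [LinearMap.range_comp, LinearMap.range_comp, Submodule.range_subtype,
        Submodule.submoduleOf, Submodule.map_comap_subtype, inf_eq_right.2 hcc,
        PolyRep.map_sub_map, ← h.torsionBy_eq_span]
      congr 1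
      ext x
      rw [Submodule.mem_torsionBy_iff]
      constructor
      · rintro ⟨y, hy, rfl⟩
        change p • p ^ i • y = 0
        rw [← mul_smul, ← pow_succ']
        exact hy
      · intro hx
        obtain ⟨y, hy⟩ := (Function.Surjective.iterate (f := fun m : P => p • m) hsurj i) x
        replace hy : p ^ i • y = x := by rwa [smul_iterate] at hy
        refine ⟨y, ?_, hy⟩
        change p ^ (i + 1) • y = 0
        rw [pow_succ', mul_smul, hy, hx]
    exact (isSimpleRegular_sub_span h.ne_zero h.smul_eq_zero hp0 b).congr
      (((Submodule.quotEquivOfEq _ _ hker.symm).trans g.quotKerEquivRange).trans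
        (LinearEquiv.ofEq _ _ hrange)).symm

/-- The representation attached to a divisible `p`-primary module is a Prüfer module. -/
theorem isPrufer_polyRep (h : IsUniserialAt p v) (hp0 : p ≠ 0)
    (hsurj : ∀ m : P, ∃ m', p • m' = m) (b : Bool) {U : Type w} [AddCommGroup U]
    [Module (KroneckerAlgebra k) U]
    (f : PolyRep k b (k[X] ⧸ Ideal.span {p}) ≃ₗ[KroneckerAlgebra k] U) :
    IsPrufer k (PolyRep k b P) U := by
  have hmono {i j : ℕ} (hij : i ≤ j) :
      Submodule.torsionBy k[X] P (p ^ i) ≤ Submodule.torsionBy k[X] P (p ^ j) :=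
    Submodule.torsionBy_le_torsionBy_of_dvd _ _ (pow_dvd_pow p hij)
  refine ⟨fun i => PolyRep.sub b (Submodule.torsionBy k[X] P (p ^ i)), fun i j hij =>
    PolyRep.sub_le_sub_iff.2 (hmono hij), ?_, fun n hn => ?_⟩
  · rw [eq_top_iff]
    intro m _
    obtain ⟨i, hi⟩ := h.torsion m.1
    obtain ⟨j, hj⟩ := h.torsion m.2
    exact Submodule.mem_iSup_of_mem (max i j)
      ⟨hmono (le_max_left i j) hi, hmono (le_max_right i j) hj⟩
  · have hv : v ∈ Submodule.torsionBy k[X] P (p ^ n) :=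
      hmono hn (by rw [Submodule.mem_torsionBy_iff, pow_one, h.smul_eq_zero])
    have hfin := finite_torsionBy (k := k) h hp0 hsurj n
    have hind := isIndecomposable_sub (b := b) h (Q := Submodule.torsionBy k[X] P (p ^ n))
      (fun h0 => h.ne_zero (by rwa [h0, Submodule.mem_bot] at hv))
    have hdef : defect k (PolyRep.sub b (Submodule.torsionBy k[X] P (p ^ n))) = 0 := by
      rw [← defect_congr (PolyRep.subEquiv b _), PolyRep.defect_eq_zero]
    have : Module.Finite k (PolyRep.sub b (Submodule.torsionBy k[X] P (p ^ n))) :=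
      Module.Finite.equiv ((PolyRep.subEquiv b _).restrictScalars k)
    refine ⟨hind, hind.isRegular hdef, hasRegularLength_sub h hp0 hsurj n, ⟨?_⟩⟩
    have hle : PolyRep.sub b (Submodule.span k[X] {v}) ≤
        PolyRep.sub b (Submodule.torsionBy k[X] P (p ^ n)) :=
      PolyRep.sub_le_sub_iff.2 ((Submodule.span_singleton_le_iff_mem _ _).2 hv)
    exact (LinearEquiv.ofEq _ _ (regularSocle_sub h hp0 hv)).trans
      ((Submodule.submoduleOfEquivOfLe hle).trans
        ((subSpanEquiv h.ne_zero h.smul_eq_zero b).symm.trans f))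

end Existence

/-- Existence of divisible `p`-primary modules. -/
theorem exists_divisible_isUniserialAt {k : Type u} [Field k] {p : k[X]} (hp : Irreducible p) :
    ∃ (P : Type u) (_ : AddCommGroup P) (_ : Module k P) (_ : Module k[X] P)
      (_ : IsScalarTower k k[X] P) (v : P), IsUniserialAt p v ∧ ∀ m : P, ∃ m', p • m' = m := by
  let F := FractionRing k[X]
  let L : Submodule k[X] F := LinearMap.range (Algebra.linearMap k[X] F)
  -- The `p`-primary part of `k(X)/k[X]`; its socle is generated by the class of `1/p`.
  let P := Submodule.torsion' k[X] (F ⧸ L) (Submonoid.powers p)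
  have hp0 : algebraMap k[X] F p ≠ 0 := fun h0 =>
    hp.ne_zero (IsFractionRing.injective k[X] F (h0.trans (map_zero _).symm))
  have hdiv (x : F) : p • ((algebraMap k[X] F p)⁻¹ * x) = x := by
    rw [Algebra.smul_def, mul_inv_cancel_left₀ hp0]
  have hmem (x : F) : L.mkQ x = 0 ↔ ∃ f, algebraMap k[X] F f = x := by
    rw [Submodule.mkQ_apply, Submodule.Quotient.mk_eq_zero]; rfl
  have htors (m : P) : ∃ n : ℕ, p ^ n • m = 0 := by
    obtain ⟨⟨_, n, rfl⟩, hn⟩ := m.2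
    exact ⟨n, Subtype.ext hn⟩
  have hpv : p • L.mkQ (algebraMap k[X] F p)⁻¹ = 0 := by
    rw [← map_smul, ← mul_one (algebraMap k[X] F p)⁻¹, hdiv, hmem]
    exact ⟨1, map_one _⟩
  refine ⟨P, inferInstance, inferInstance, inferInstance, inferInstance,
    ⟨L.mkQ (algebraMap k[X] F p)⁻¹, ⟨⟨p, 1, pow_one p⟩, hpv⟩⟩,
    ⟨htors, ?_, Subtype.ext hpv, ?_⟩, ?_⟩
  · intro h0
    obtain ⟨f, hf⟩ := (hmem _).1 (congrArg Subtype.val h0)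
    refine hp.not_isUnit (IsUnit.of_mul_eq_one f (IsFractionRing.injective k[X] F ?_))
    rw [map_mul, hf, mul_inv_cancel₀ hp0, map_one]
  · rintro ⟨w, hw⟩ h
    obtain ⟨x, rfl⟩ := L.mkQ_surjective w
    have h' : p • L.mkQ x = 0 := congrArg Subtype.val h
    rw [← map_smul, hmem] at h'
    obtain ⟨f, hf⟩ := h'
    refine Submodule.mem_span_singleton.2 ⟨f, Subtype.ext ?_⟩
    change f • L.mkQ (algebraMap k[X] F p)⁻¹ = L.mkQ x
    rw [← map_smul, Algebra.smul_def, hf, Algebra.smul_def, mul_right_comm, mul_inv_cancel₀ hp0,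
      one_mul]
  · rintro ⟨w, hw⟩
    obtain ⟨n, hn⟩ := htors ⟨w, hw⟩
    obtain ⟨x, rfl⟩ := L.mkQ_surjective w
    have h1 : p • L.mkQ ((algebraMap k[X] F p)⁻¹ * x) = L.mkQ x := by rw [← map_smul, hdiv]
    refine ⟨⟨L.mkQ ((algebraMap k[X] F p)⁻¹ * x), ⟨⟨p ^ (n + 1), n + 1, rfl⟩, ?_⟩⟩, Subtype.ext h1⟩
    change p ^ (n + 1) • L.mkQ ((algebraMap k[X] F p)⁻¹ * x) = 0
    rw [pow_succ, mul_smul, h1]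
    exact congrArg Subtype.val hn

/-! ### Submodules of type `U[n]` -/

section RayChain

variable {k : Type u} [Field k] {M : Type v} [AddCommGroup M] [Module k M]
  [Module (KroneckerAlgebra k) M] [IsScalarTower k (KroneckerAlgebra k) M]

/-- Each factor of the series is nonzero, so the dimension grows at every step. This is what makes
Prüfer modules infinite-dimensional. -/
theorem HasRegularLength.le_finrank [Module.Finite k M] {n : ℕ} (h : HasRegularLength k M n) :
    n ≤ Module.finrank k M := by
  obtain ⟨c, -, -, hc⟩ := h
  have key (i : ℕ) (hi : i ≤ n) : i ≤ Module.finrank k ((c i).restrictScalars k) := by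
    induction i with
    | zero => exact Nat.zero_le _
    | succ i ih =>
      obtain ⟨hle, hs⟩ := hc i (by omega)
      have hlt : (c i).restrictScalars k < (c (i + 1)).restrictScalars k := by
        refine lt_of_le_of_ne hle fun heq => ?_
        have heq' : c i = c (i + 1) := Submodule.restrictScalars_injective k _ _ heq
        have htop : (c i).submoduleOf (c (i + 1)) = ⊤ := by
          rw [heq', Submodule.submoduleOf_self]
        have := hs.1
        rw [htop] at this
        exact not_subsingleton ((c (i + 1)) ⧸ (⊤ : Submodule (KroneckerAlgebra k) (c (i + 1))))
          inferInstance
      have := Submodule.finrank_lt_finrank_of_lt hlt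
      have := ih (by omega)
      omega
  exact (key n le_rfl).trans (Submodule.finrank_le _)

/-- The properties of a submodule isomorphic to `U[n]` that determine Prüfer modules. -/
structure IsRaySubmodule (k : Type u) [Field k] {M : Type v} [AddCommGroup M] [Module k M]
    [Module (KroneckerAlgebra k) M] [IsScalarTower k (KroneckerAlgebra k) M]
    (U : Type w) [AddCommGroup U] [Module (KroneckerAlgebra k) U] (n : ℕ)
    (N : Submodule (KroneckerAlgebra k) M) : Prop where
  finite : Module.Finite k N
  le_finrank : n ≤ Module.finrank k N
  defect_eq_zero : defect k N = 0
  isIndecomposable : IsIndecomposable (KroneckerAlgebra k) N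
  exists_socle : ∃ S ≤ N, Nonempty (S ≃ₗ[KroneckerAlgebra k] U) ∧
    ∀ T : Submodule (KroneckerAlgebra k) M, T ≤ N → IsSimpleRegular k T → T ≤ S

theorem IsRayModule.isRaySubmodule {U : Type w} [AddCommGroup U] [Module (KroneckerAlgebra k) U]
    {n : ℕ} {N : Submodule (KroneckerAlgebra k) M} (h : IsRayModule k N U n) :
    IsRaySubmodule k U n N := by
  obtain ⟨hind, hreg, hlen, ⟨f⟩⟩ := h
  have hfin := hreg.1
  refine ⟨hfin, hlen.le_finrank, hreg.defect_eq_zero, hind, (regularSocle k N).map N.subtype,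
    Submodule.map_subtype_le _ _,
    ⟨(Submodule.equivMapOfInjective _ N.subtype_injective _).symm.trans f⟩, fun T hT hs => ?_⟩
  have hle : T.submoduleOf N ≤ regularSocle k N :=
    le_sSup (hs.congr (Submodule.submoduleOfEquivOfLe hT).symm)
  have := Submodule.map_mono (f := N.subtype) hle
  rwa [Submodule.submoduleOf, Submodule.map_comap_subtype, inf_eq_right.2 hT] at this

theorem IsRaySubmodule.map {M' : Type*} [AddCommGroup M'] [Module k M']
    [Module (KroneckerAlgebra k) M'] [IsScalarTower k (KroneckerAlgebra k) M']
    {U : Type w} [AddCommGroup U] [Module (KroneckerAlgebra k) U]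
    {n : ℕ} {N : Submodule (KroneckerAlgebra k) M} (f : M ≃ₗ[KroneckerAlgebra k] M')
    (h : IsRaySubmodule k U n N) : IsRaySubmodule k U n (N.map f.toLinearMap) := by
  obtain ⟨hfin, hlen, hdef, hind, S, hS, ⟨g⟩, hmax⟩ := h
  let e := f.submoduleMap N
  refine ⟨Module.Finite.equiv (e.restrictScalars k), ?_, ?_, isIndecomposable_congr e hind,
    S.map f.toLinearMap, Submodule.map_mono hS, ⟨(f.submoduleMap S).symm.trans g⟩,
    fun T hT hs => ?_⟩
  · exact hlen.trans (e.restrictScalars k).finrank_eq.le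
  · exact (defect_congr e).symm.trans hdef
  · have h1 := Submodule.map_mono (f := f.symm.toLinearMap) hT
    have h2 (A : Submodule (KroneckerAlgebra k) M) :
        (A.map f.toLinearMap).map f.symm.toLinearMap = A := by
      rw [← Submodule.map_comp]; simp
    have h3 : (T.map f.symm.toLinearMap).map f.toLinearMap = T := by
      rw [← Submodule.map_comp]; simp
    rw [h2] at h1
    have := Submodule.map_mono (f := f.toLinearMap) (hmax _ h1 (hs.congr (f.symm.submoduleMap T)))
    rwa [h3] at this

end RayChain

/-! ### Bijectivity of one arrow -/

section OfMaps

variable {k : Type u} [Field k] {M : Type v} [AddCommGroup M] [Module k M]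
  [Module (KroneckerAlgebra k) M] [IsScalarTower k (KroneckerAlgebra k) M] {b : Bool}

theorem e₂_mul_e₁ : e₂ k * e₁ k = 0 := by ext <;> simp [e₁, e₂]

theorem e₁_mul_e₂ : e₁ k * e₂ k = 0 := by ext <;> simp [e₁, e₂]

theorem arrow_mul_e₁ : arrow k b * e₁ k = 0 := by cases b <;> ext <;> simp [e₁, arrow]

theorem e₁_mul_arrow : e₁ k * arrow k b = arrow k b := by cases b <;> ext <;> simp [e₁, arrow]

theorem e₂_mul (r : KroneckerAlgebra k) : e₂ k * r = r.b • e₂ k := by ext <;> simp [e₂]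

theorem eq_smul_add (r : KroneckerAlgebra k) :
    r = r.a • e₁ k + r.c • arrow k false + r.d • arrow k true + r.b • e₂ k := by
  ext <;> simp [e₁, e₂, arrow]

variable {P : Type w} [AddCommGroup P] [Module k P] [Module k[X] P] [IsScalarTower k k[X] P]

/-- Linear maps out of `PolyRep k b P`. -/
def PolyRep.ofMaps (g₁ g₂ : P →ₗ[k] M) (h₁ : ∀ x, e₁ k • g₁ x = g₁ x)
    (h₂ : ∀ x, e₂ k • g₂ x = g₂ x) (h : ∀ x, arrow k b • g₂ x = g₁ x)
    (h' : ∀ x, arrow k (!b) • g₂ x = g₁ ((X : k[X]) • x)) :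
    PolyRep k b P →ₗ[KroneckerAlgebra k] M where
  toFun m := g₁ m.1 + g₂ m.2
  map_add' m n := by
    rw [Rep.add_fst, Rep.add_snd, map_add, map_add, add_add_add_comm]
  map_smul' r m := by
    -- The exclusive or is `false`, with coefficient `1`, exactly for the arrow `i = b`.
    have hc : ∀ (i : Bool) (y : P), arrow k i • g₂ y = g₁ (coef k (i ^^ b) • y) := by
      intro i y
      cases i <;> cases b <;> simp_all [coef]
    have h3 (i : Bool) (x : P) : arrow k i • g₁ x = 0 := by
      rw [← h₁, ← mul_smul, arrow_mul_e₁, zero_smul]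
    have h4 (x : P) : e₂ k • g₁ x = 0 := by rw [← h₁, ← mul_smul, e₂_mul_e₁, zero_smul]
    have h5 (x : P) : e₁ k • g₂ x = 0 := by rw [← h₂, ← mul_smul, e₁_mul_e₂, zero_smul]
    rw [RingHom.id_apply]
    conv_rhs => rw [eq_smul_add r]
    simp only [add_smul, smul_add, smul_assoc, h₁, h₂, h3, h4, h5, hc, smul_zero, add_zero,
      zero_add, Rep.smul_fst, Rep.smul_snd, map_add, map_smul]
    cases b <;> simp [coef] <;> abel

end OfMaps

section Arrow

variable {k : Type u} [Field k] {M : Type v} [AddCommGroup M] [Module k M]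
  [Module (KroneckerAlgebra k) M] [IsScalarTower k (KroneckerAlgebra k) M] {b : Bool}

/-- An element of `e₂ M` killed by both arrows spans a direct summand, so it does not exist in an
indecomposable module of defect zero. -/
theorem eq_zero_of_arrows_smul_eq_zero {N : Submodule (KroneckerAlgebra k) M}
    [Module.Finite k N] (hdef : defect k N = 0) (hind : IsIndecomposable (KroneckerAlgebra k) N)
    {x : M} (hxN : x ∈ N) (hx : e₂ k • x = x) (h : ∀ i, arrow k i • x = 0) : x = 0 := by
  by_contra hx0
  have he₁ : e₁ k • x = 0 := by rw [← hx, ← mul_smul, e₁_mul_e₂, zero_smul]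
  have hsmul (r : KroneckerAlgebra k) : r • x = r.b • x := by
    conv_lhs => rw [eq_smul_add r]
    simp only [add_smul, smul_assoc, he₁, h, hx, smul_zero, zero_add]
  obtain ⟨l, hl⟩ := LinearMap.exists_leftInverse_of_injective (LinearMap.toSpanSingleton k M x)
    (LinearMap.ker_toSpanSingleton k hx0)
  have hlx (t : k) : l (t • x) = t := LinearMap.congr_fun hl t
  -- The complement of `k x` in `N`. It is a submodule because `e₂` turns every algebra element into
  -- a scalar: vertex `2` is a source.
  let B : Submodule (KroneckerAlgebra k) M :=
    { carrier := {m | m ∈ N ∧ l (e₂ k • m) = 0}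
      add_mem' := fun ha hb => ⟨N.add_mem ha.1 hb.1, by
        rw [smul_add, map_add, ha.2, hb.2, add_zero]⟩
      zero_mem' := ⟨N.zero_mem, by rw [smul_zero, map_zero]⟩
      smul_mem' := fun r m hm => ⟨N.smul_mem r hm.1, by
        rw [← mul_smul, e₂_mul, smul_assoc, map_smul, hm.2, smul_zero]⟩ }
  have hmemA {m : M} (hm : m ∈ Submodule.span (KroneckerAlgebra k) {x}) : ∃ t : k, m = t • x := by
    obtain ⟨r, rfl⟩ := Submodule.mem_span_singleton.1 hm
    exact ⟨r.b, hsmul r⟩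
  have hmemA' (t : k) : t • x ∈ Submodule.span (KroneckerAlgebra k) {x} :=
    Submodule.smul_of_tower_mem _ t (Submodule.mem_span_singleton_self x)
  have hinf : Submodule.span (KroneckerAlgebra k) {x} ⊓ B = ⊥ := by
    rw [eq_bot_iff]
    rintro m ⟨hA, -, hB⟩
    obtain ⟨t, rfl⟩ := hmemA hA
    rw [smul_comm, hx, hlx] at hB
    rw [hB, zero_smul]
    exact Submodule.zero_mem _
  have hsup : Submodule.span (KroneckerAlgebra k) {x} ⊔ B = N := by
    refine le_antisymm (sup_le ((Submodule.span_singleton_le_iff_mem _ _).2 hxN)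
      fun m hm => hm.1) fun m hm => ?_
    refine Submodule.mem_sup.2 ⟨l (e₂ k • m) • x, hmemA' _, m - l (e₂ k • m) • x, ⟨?_, ?_⟩, ?_⟩
    · exact N.sub_mem hm (N.smul_of_tower_mem _ hxN)
    · rw [smul_sub, map_sub, smul_comm, hx, hlx, sub_self]
    · rw [add_sub_cancel]
  rcases (isIndecomposable_submodule_iff.1 hind).2 _ _ hinf hsup with h0 | h0
  · exact hx0 ((Submodule.mem_bot _).1 (h0 ▸ Submodule.mem_span_singleton_self x))
  -- Here `N = k x` is concentrated at vertex `2`, so defect zero forces `e₂ N = 0`.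
  · rw [h0, sup_bot_eq] at hsup
    have h1 : subCorner N (e₁ k) = ⊥ := by
      rw [eq_bot_iff]
      intro m hm
      rw [mem_subCorner e₁_mul_e₁, ← hsup] at hm
      obtain ⟨t, rfl⟩ := hmemA hm.1
      rw [← hm.2, smul_comm, he₁, smul_zero]
      exact Submodule.zero_mem _
    rw [defect, ← finrank_subCorner N (e₁ k), h1, finrank_bot, Nat.cast_zero, sub_zero,
      ← finrank_subCorner] at hdef
    have hfin : Module.Finite k (subCorner N (e₂ k)) := by
      unfold subCorner
      infer_instance
    have hbot : subCorner N (e₂ k) = ⊥ := Submodule.finrank_eq_zero.1 (by exact_mod_cast hdef)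
    exact hx0 ((Submodule.mem_bot k).1 (hbot ▸ (mem_subCorner e₂_mul_e₂).2 ⟨hxN, hx⟩))

variable {p : k[X]} {n : ℕ} {N : Submodule (KroneckerAlgebra k) M}

theorem X_smul_quotient (x : k[X] ⧸ Ideal.span {(X - C 0 : k[X])}) : (X : k[X]) • x = 0 := by
  obtain ⟨f, rfl⟩ := Ideal.Quotient.mk_surjective x
  change Ideal.Quotient.mk _ (X * f) = 0
  rw [Ideal.Quotient.eq_zero_iff_mem, Ideal.mem_span_singleton]
  simp

/-- The arrow that acts bijectively on `U` acts injectively on `U[n]`. -/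
theorem IsRaySubmodule.eq_zero_of_arrow_smul {U : Type w} [AddCommGroup U]
    [Module (KroneckerAlgebra k) U]
    (hU : ∀ x : U, e₂ k • x = x → arrow k b • x = 0 → x = 0)
    (h : IsRaySubmodule k U n N) {x : M} (hxN : x ∈ N) (hx : e₂ k • x = x)
    (hb : arrow k b • x = 0) : x = 0 := by
  have hfin := h.finite
  by_contra hx0
  have hb' : arrow k (!b) • x ≠ 0 := fun h0 =>
    hx0 (eq_zero_of_arrows_smul_eq_zero h.defect_eq_zero h.isIndecomposable hxN hx fun i => by
      rcases Bool.eq_or_eq_not i b with rfl | rfl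
      exacts [hb, h0])
  have hirr : Irreducible (X - C 0 : k[X]) := irreducible_X_sub_C 0
  have hmax : (Ideal.span {(X - C 0 : k[X])}).IsMaximal :=
    PrincipalIdealRing.isMaximal_of_irreducible hirr
  let ε : (k[X] ⧸ Ideal.span {(X - C 0 : k[X])}) ≃ₗ[k] k :=
    (quotientSpanXSubCAlgEquiv (0 : k)).toLinearEquiv
  -- `x` and its nonzero image under the other arrow span a copy of the simple regular module on
  -- which `arrow k b` is zero. It lies in the socle, but `arrow k b` is injective on `U`.
  let F : PolyRep k (!b) (k[X] ⧸ Ideal.span {(X - C 0 : k[X])}) →ₗ[KroneckerAlgebra k] M :=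
    PolyRep.ofMaps (LinearMap.toSpanSingleton k M (arrow k (!b) • x) ∘ₗ ε.toLinearMap)
      (LinearMap.toSpanSingleton k M x ∘ₗ ε.toLinearMap)
      (fun y => by
        change e₁ k • ε y • arrow k (!b) • x = ε y • arrow k (!b) • x
        rw [smul_comm, ← mul_smul, e₁_mul_arrow])
      (fun y => by
        change e₂ k • ε y • x = ε y • x
        rw [smul_comm, hx])
      (fun y => smul_comm _ _ _)
      (fun y => by
        rw [X_smul_quotient, LinearMap.map_zero, Bool.not_not]
        change arrow k b • ε y • x = 0
        rw [smul_comm, hb, smul_zero])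
  have hF (m) : F m = ε m.1 • arrow k (!b) • x + ε m.2 • x := rfl
  have hinj : Function.Injective F := by
    rw [injective_iff_map_eq_zero]
    intro m hm
    have hm2 : e₂ k • F m = 0 := by rw [hm, smul_zero]
    have h12 : e₂ k * arrow k (!b) = 0 := by
      rw [← e₁_mul_arrow, ← mul_assoc, e₂_mul_e₁, zero_mul]
    have hcomm (t : k) (y : M) : e₂ k • t • y = t • e₂ k • y := smul_comm _ _ _
    rw [hF, smul_add, hcomm, hcomm, ← mul_smul (e₂ k), h12, zero_smul, smul_zero,
      zero_add, hx, smul_eq_zero_iff_left hx0] at hm2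
    rw [hF, hm2, zero_smul, add_zero, smul_eq_zero_iff_left hb'] at hm
    exact PolyRep.ext (by simpa using hm) (by simpa using hm2)
  have hrange : LinearMap.range F ≤ N := by
    rintro _ ⟨m, rfl⟩
    rw [hF]
    exact N.add_mem (N.smul_of_tower_mem _ (N.smul_mem _ hxN)) (N.smul_of_tower_mem _ hxN)
  obtain ⟨S, -, ⟨g⟩, hS⟩ := h.exists_socle
  have hle := hS _ hrange
    ((isSimpleRegular_quotient hirr.ne_zero (!b)).congr (LinearEquiv.ofInjective F hinj))
  have hxS : x ∈ S := hle ⟨PolyRep.mk 0 (ε.symm 1), by simp [hF]⟩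
  have := hU (g ⟨x, hxS⟩)
    (by rw [← map_smul]; exact congrArg g (Subtype.ext hx))
    (by rw [← map_smul, ← map_zero g]; exact congrArg g (Subtype.ext hb))
  rw [LinearEquiv.map_eq_zero_iff] at this
  exact hx0 (congrArg Subtype.val this)

/-- The linear map between corner spaces given by an arrow. -/
def cornerMap (k : Type u) [Field k] (M : Type v) [AddCommGroup M] [Module k M]
    [Module (KroneckerAlgebra k) M] [IsScalarTower k (KroneckerAlgebra k) M] (i : Bool) :
    cornerSpace k M (e₂ k) →ₗ[k] cornerSpace k M (e₁ k) :=
  (Algebra.lsmul k k M (arrow k i)).restrict fun x _ => ⟨arrow k i • x, by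
    change e₁ k • arrow k i • x = arrow k i • x
    rw [← mul_smul, e₁_mul_arrow]⟩

theorem smul_eq_of_mem_cornerSpace {e : KroneckerAlgebra k} (he : e * e = e) {x : M}
    (hx : x ∈ cornerSpace k M e) : e • x = x := by
  obtain ⟨y, rfl⟩ := hx
  change e • e • y = e • y
  rw [← mul_smul, he]

/-- Defect zero makes the corners of `N` equidimensional, so the injective arrow is surjective. -/
theorem exists_arrow_smul_eq [Module.Finite k N] (hdef : defect k N = 0)
    (hinj : ∀ x ∈ N, e₂ k • x = x → arrow k b • x = 0 → x = 0) {y : M} (hy : y ∈ N)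
    (hy' : e₁ k • y = y) : ∃ x ∈ N, e₂ k • x = x ∧ arrow k b • x = y := by
  have h1 : Function.Injective (cornerMap k N b) := by
    rw [injective_iff_map_eq_zero]
    rintro ⟨⟨x, hxN⟩, hx⟩ h0
    have h2 := hinj x hxN (congrArg Subtype.val (smul_eq_of_mem_cornerSpace e₂_mul_e₂ hx))
      (congrArg Subtype.val (congrArg Subtype.val h0))
    exact Subtype.ext (Subtype.ext h2)
  rw [defect, sub_eq_zero] at hdef
  rw [LinearMap.injective_iff_surjective_of_finrank_eq_finrank (by exact_mod_cast hdef)] at h1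
  obtain ⟨⟨⟨x, hxN⟩, hx⟩, hxy⟩ := h1 ⟨⟨y, hy⟩, ⟨⟨y, hy⟩, Subtype.ext hy'⟩⟩
  exact ⟨x, hxN, congrArg Subtype.val (smul_eq_of_mem_cornerSpace e₂_mul_e₂ hx),
    congrArg Subtype.val (congrArg Subtype.val hxy)⟩

/-- A module on which one of the arrows acts bijectively comes from a `k[X]`-module. -/
theorem exists_polyRep_equiv (h : Function.Bijective (cornerMap k M b)) :
    ∃ (P : Type v) (_ : AddCommGroup P) (_ : Module k P) (_ : Module k[X] P)
      (_ : IsScalarTower k k[X] P), Nonempty (PolyRep k b P ≃ₗ[KroneckerAlgebra k] M) := by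
  let A := LinearEquiv.ofBijective _ h
  -- After identifying the two vertices through the bijective arrow, `X` acts on `e₁ M` as the other
  -- arrow.
  let T : Module.End k (cornerSpace k M (e₁ k)) := cornerMap k M (!b) ∘ₗ A.symm.toLinearMap
  let o := (Module.AEval'.of T).symm
  refine ⟨Module.AEval' T, inferInstance, inferInstance, inferInstance, inferInstance, ⟨?_⟩⟩
  let F : PolyRep k b (Module.AEval' T) →ₗ[KroneckerAlgebra k] M :=
    PolyRep.ofMaps ((cornerSpace k M (e₁ k)).subtype ∘ₗ o.toLinearMap)
      ((cornerSpace k M (e₂ k)).subtype ∘ₗ A.symm.toLinearMap ∘ₗ o.toLinearMap)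
      (fun x => smul_eq_of_mem_cornerSpace e₁_mul_e₁ (o x).2)
      (fun x => smul_eq_of_mem_cornerSpace e₂_mul_e₂ (A.symm (o x)).2)
      (fun x => congrArg Subtype.val (A.apply_symm_apply (o x)))
      (fun x => by
        obtain ⟨y, rfl⟩ := (Module.AEval'.of T).surjective x
        change _ = ((o ((X : k[X]) • Module.AEval'.of T y) : cornerSpace k M (e₁ k)) : M)
        rw [Module.AEval'.X_smul_of, LinearEquiv.symm_apply_apply]
        change arrow k (!b) • ((A.symm (o (Module.AEval'.of T y)) : cornerSpace k M (e₂ k)) : M) = _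
        rw [LinearEquiv.symm_apply_apply]
        rfl)
  have hF (m) : F m = (o m.1 : M) + (A.symm (o m.2) : M) := rfl
  refine LinearEquiv.ofBijective F ⟨?_, ?_⟩
  · rw [injective_iff_map_eq_zero]
    intro m hm
    have h1 := smul_eq_of_mem_cornerSpace e₁_mul_e₁ (o m.1).2
    have h2 := smul_eq_of_mem_cornerSpace e₂_mul_e₂ (A.symm (o m.2)).2
    have h3 : (o m.1 : M) = 0 := by
      have := congrArg (e₁ k • ·) hm
      simp only [hF, smul_add, smul_zero, h1] at this
      rwa [← h2, ← mul_smul, e₁_mul_e₂, zero_smul, add_zero] at this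
    have h4 : (A.symm (o m.2) : M) = 0 := by rwa [hF, h3, zero_add] at hm
    exact PolyRep.ext (by simpa using h3) (by simpa using h4)
  · intro m
    refine ⟨PolyRep.mk (o.symm ⟨e₁ k • m, m, rfl⟩) (o.symm (A ⟨e₂ k • m, m, rfl⟩)), ?_⟩
    rw [hF]
    simp [e₁_smul_add_e₂_smul]

end Arrow

/-! ### Structure and endomorphisms of an arbitrary Prüfer module -/

section Prufer

variable {k : Type u} [Field k] {b : Bool} {P : Type v} [AddCommGroup P] [Module k P]
  [Module k[X] P] [IsScalarTower k k[X] P] {p : k[X]}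

/-- Fitting's decomposition for multiplication by `p` on `Q` gives a decomposition of the
representation, in which one part must vanish. -/
theorem isPrimary_or_injective_of_isIndecomposable {Q : Submodule k[X] P} [Module.Finite k Q]
    (hind : IsIndecomposable (KroneckerAlgebra k) (PolyRep.sub b Q)) (p : k[X]) :
    (∀ x ∈ Q, ∃ n : ℕ, p ^ n • x = 0) ∨ ∀ x ∈ Q, p • x = 0 → x = 0 := by
  have hind' := isIndecomposable_congr (PolyRep.subEquiv b Q).symm hind
  have : IsNoetherian k[X] Q := isNoetherian_of_tower k inferInstance
  have : IsArtinian k[X] Q := isArtinian_of_tower k inferInstance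
  let φ : Module.End k[X] Q := algebraMap k[X] (Module.End k[X] Q) p
  have hφ (n : ℕ) (x : Q) : (φ ^ n) x = p ^ n • x := by rw [← map_pow]; rfl
  have hcompl := φ.isCompl_iSup_ker_pow_iInf_range_pow
  have hcompl' : IsCompl (PolyRep.sub b (⨆ n, LinearMap.ker (φ ^ n)))
      (PolyRep.sub b (⨅ n, LinearMap.range (φ ^ n))) := by
    rw [isCompl_iff, disjoint_iff, codisjoint_iff, ← PolyRep.sub_inf, ← PolyRep.sub_sup,
      hcompl.inf_eq_bot, hcompl.sup_eq_top, PolyRep.sub_bot, PolyRep.sub_top]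
    exact ⟨rfl, rfl⟩
  rcases hind'.2 _ _ hcompl' with h0 | h0 <;> rw [← PolyRep.sub_bot (b := b)] at h0 <;>
    replace h0 := PolyRep.sub_injective h0
  · right
    intro x hx hpx
    have : (⟨x, hx⟩ : Q) ∈ ⨆ n, LinearMap.ker (φ ^ n) :=
      Submodule.mem_iSup_of_mem 1 (by
        rw [LinearMap.mem_ker, hφ, pow_one]
        exact Subtype.ext hpx)
    rw [h0, Submodule.mem_bot] at this
    exact congrArg Subtype.val this
  · left
    intro x hx
    have hs := hcompl.sup_eq_top
    rw [h0, sup_bot_eq] at hs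
    have hx' : (⟨x, hx⟩ : Q) ∈ ⨆ n, LinearMap.ker (φ ^ n) := by rw [hs]; trivial
    obtain ⟨n, hn⟩ := (Submodule.mem_iSup_of_chain φ.iterateKer _).1 hx'
    refine ⟨n, ?_⟩
    rw [LinearMap.iterateKer_coe, LinearMap.mem_ker, hφ] at hn
    exact congrArg Subtype.val hn

variable [hp : (Ideal.span {p}).IsMaximal]

/-- The structure of the `k[X]`-module of `U[n]`, for `U` simple regular. -/
theorem IsRaySubmodule.exists_eq_sub (hp0 : p ≠ 0) {n : ℕ}
    {N : Submodule (KroneckerAlgebra k) (PolyRep k b P)}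
    (h : IsRaySubmodule k (PolyRep k b (k[X] ⧸ Ideal.span {p})) n N) :
    ∃ Q : Submodule k[X] P, N = PolyRep.sub b Q ∧ (∀ x ∈ Q, ∃ n : ℕ, p ^ n • x = 0) ∧
      ∃ v ∈ Q, v ≠ 0 ∧ p • v = 0 ∧ ∀ w ∈ Q, p • w = 0 → w ∈ Submodule.span k[X] {v} := by
  have := h.finite
  obtain ⟨Q, rfl⟩ := PolyRep.exists_eq_sub N h.defect_eq_zero
  obtain ⟨S, hS, ⟨g⟩, hmax⟩ := h.exists_socle
  -- By fullness, the embedding of `U` onto the socle comes from a `k[X]`-linear map; the image of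
  -- `1` generates the socle.
  obtain ⟨φ, hφ⟩ := PolyRep.exists_map_eq (S.subtype ∘ₗ g.symm.toLinearMap)
  have hSsub : S = PolyRep.sub b (Submodule.span k[X] {φ 1}) := by
    have h1 : LinearMap.range (S.subtype ∘ₗ g.symm.toLinearMap) = S := by
      rw [LinearMap.range_comp, LinearEquiv.range, Submodule.map_subtype_top]
    have h2 : (⊤ : Submodule k[X] (k[X] ⧸ Ideal.span {p})) = Submodule.span k[X] {1} := by
      rw [eq_comm, eq_top_iff]
      intro x _
      obtain ⟨f, rfl⟩ := Ideal.Quotient.mk_surjective x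
      refine Submodule.mem_span_singleton.2 ⟨f, ?_⟩
      rw [← map_one (Ideal.Quotient.mk (Ideal.span {p}))]
      change Ideal.Quotient.mk _ (f * 1) = _
      rw [mul_one]
    rw [← h1, ← hφ, LinearMap.range_eq_map, ← PolyRep.sub_top, PolyRep.map_sub_map, h2,
      Submodule.map_span, Set.image_singleton]
  have hvQ : φ 1 ∈ Q := PolyRep.sub_le_sub_iff.1 (hSsub ▸ hS) (Submodule.mem_span_singleton_self _)
  have hv0 : φ 1 ≠ 0 := by
    intro h0
    have h1 : (S.subtype ∘ₗ g.symm.toLinearMap) (PolyRep.mk 1 0) = 0 := by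
      rw [← hφ]
      exact PolyRep.ext h0 (map_zero φ)
    have h2 : (PolyRep.mk 1 0 : PolyRep k b (k[X] ⧸ Ideal.span {p})) = 0 := by
      simpa using h1
    exact one_ne_zero (congrArg Prod.fst h2)
  have hpv : p • φ 1 = 0 := by
    rw [← map_smul]
    have : p • (1 : k[X] ⧸ Ideal.span {p}) = 0 := by
      rw [← map_one (Ideal.Quotient.mk (Ideal.span {p}))]
      change Ideal.Quotient.mk _ (p * 1) = _
      rw [mul_one, Ideal.Quotient.eq_zero_iff_mem]
      exact Ideal.mem_span_singleton_self p
    rw [this, map_zero]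
  have : Module.Finite k Q :=
    Module.Finite.of_injective (((PolyRep.subEquiv b Q).toLinearMap.restrictScalars k) ∘ₗ
      PolyRep.inl k b Q) ((PolyRep.subEquiv b Q).injective.comp PolyRep.inl_injective)
  refine ⟨Q, rfl, ?_, φ 1, hvQ, hv0, hpv, fun w hw hpw => ?_⟩
  · exact (isPrimary_or_injective_of_isIndecomposable h.isIndecomposable p).resolve_right
      fun h' => hv0 (h' _ hvQ hpv)
  · by_cases hw0 : w = 0
    · rw [hw0]; exact Submodule.zero_mem _
    have hle := hmax _ (PolyRep.sub_le_sub_iff.2 ((Submodule.span_singleton_le_iff_mem w Q).2 hw))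
      (isSimpleRegular_sub_span hw0 hpw hp0 b)
    rw [hSsub, PolyRep.sub_le_sub_iff] at hle
    exact hle (Submodule.mem_span_singleton_self w)

/-- All members of the chain share the socle of the first. A cyclic `P` would be finite-dimensional,
whereas the members have unbounded dimension; so `P` is divisible. -/
theorem exists_isUniserialAt_of_chain (hp0 : p ≠ 0)
    {c : ℕ → Submodule (KroneckerAlgebra k) (PolyRep k b P)} (hmono : Monotone c)
    (htop : ⨆ n, c n = ⊤)
    (hc : ∀ n, 1 ≤ n → IsRaySubmodule k (PolyRep k b (k[X] ⧸ Ideal.span {p})) n (c n)) :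
    ∃ v : P, IsUniserialAt p v ∧ ∀ m : P, ∃ m', p • m' = m := by
  -- The index is shifted because the chain is only controlled from `1` on.
  choose Q hQ htors v hvQ hv0 hpv hspan using fun n : ℕ =>
    (hc (n + 1) (Nat.le_add_left 1 n)).exists_eq_sub hp0
  have hmem (x : P) : ∃ n, x ∈ Q n := by
    have hx : PolyRep.mk x 0 ∈ ⨆ n, c n := by rw [htop]; trivial
    obtain ⟨n, hn⟩ := (Submodule.mem_iSup_of_chain ⟨c, hmono⟩ _).1 hx
    have hn' := hmono (Nat.le_succ n) hn
    rw [Nat.succ_eq_add_one, hQ n] at hn'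
    exact ⟨n, hn'.1⟩
  have hle (n : ℕ) : Q 0 ≤ Q n := by
    rw [← PolyRep.sub_le_sub_iff (b := b), ← hQ, ← hQ]
    exact hmono (by omega)
  have huni : IsUniserialAt p (v 0) := by
    refine ⟨fun m => ?_, hv0 0, hpv 0, fun w hw => ?_⟩
    · obtain ⟨n, hn⟩ := hmem m
      exact htors n m hn
    · obtain ⟨n, hn⟩ := hmem w
      obtain ⟨f, hf⟩ := Submodule.mem_span_singleton.1
        (hspan n (v 0) (hle n (hvQ 0)) (hpv 0))
      have h1 := mem_span_smul_of_isMaximal (f := f) (hpv n) (by rw [hf]; exact hv0 0)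
      rw [hf] at h1
      exact (Submodule.span_singleton_le_iff_mem _ _).2 h1 (hspan n w hn hw)
  refine ⟨v 0, huni, huni.exists_span_eq_top_or.resolve_left ?_⟩
  rintro ⟨w, hw⟩
  obtain ⟨a, ha⟩ := huni.torsion w
  have hfin := finite_span_singleton (k := k) (pow_ne_zero a hp0) ha
  rw [hw] at hfin
  have : Module.Finite k P := Module.Finite.equiv
    ((Submodule.topEquiv : (⊤ : Submodule k[X] P) ≃ₗ[k[X]] P).restrictScalars k)
  have h1 := (hc (Module.finrank k (PolyRep k b P) + 1) (by omega)).le_finrank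
  have h2 := Submodule.finrank_le ((c (Module.finrank k (PolyRep k b P) + 1)).restrictScalars k)
  exact absurd (h1.trans h2) (by omega)

/-- The endomorphism ring of a Prüfer module. -/
theorem IsPrufer.nonempty_end_ringEquiv (hp0 : p ≠ 0) {M : Type v} [AddCommGroup M] [Module k M]
    [Module (KroneckerAlgebra k) M] [IsScalarTower k (KroneckerAlgebra k) M]
    {U : Type w} [AddCommGroup U] [Module (KroneckerAlgebra k) U]
    (f : PolyRep k b (k[X] ⧸ Ideal.span {p}) ≃ₗ[KroneckerAlgebra k] U) (h : IsPrufer k M U) :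
    Nonempty (Module.End (KroneckerAlgebra k) M ≃+* PowerSeries (k[X] ⧸ Ideal.span {p})) := by
  obtain ⟨c, hmono, htop, hc⟩ := h
  have hc' (n : ℕ) (hn : 1 ≤ n) :
      IsRaySubmodule k (PolyRep k b (k[X] ⧸ Ideal.span {p})) n (c n) := by
    obtain ⟨h1, h2, h3, ⟨g⟩⟩ := hc n hn
    exact IsRayModule.isRaySubmodule ⟨h1, h2, h3, ⟨g.trans f.symm⟩⟩
  have hmem (x : M) : ∃ n, 1 ≤ n ∧ x ∈ c n := by
    have hx : x ∈ ⨆ n, c n := by rw [htop]; trivial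
    obtain ⟨n, hn⟩ := (Submodule.mem_iSup_of_chain ⟨c, hmono⟩ _).1 hx
    exact ⟨n + 1, Nat.le_add_left 1 n, hmono (Nat.le_succ n) hn⟩
  have hinj (n : ℕ) (hn : 1 ≤ n) (x : M) (hxn : x ∈ c n) (hx : e₂ k • x = x)
      (hb : arrow k b • x = 0) : x = 0 := by
    refine (hc' n hn).eq_zero_of_arrow_smul (b := b) (fun y hy hby => ?_) hxn hx hb
    rw [PolyRep.arrow_smul] at hby
    rw [← hy, PolyRep.e₂_smul, show y.2 = 0 from congrArg Prod.fst hby]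
    rfl
  -- Both properties are checked on the members of the chain, where injectivity and defect zero give
  -- surjectivity.
  have hbij : Function.Bijective (cornerMap k M b) := by
    constructor
    · rw [injective_iff_map_eq_zero]
      rintro ⟨x, hx⟩ h0
      obtain ⟨n, hn, hxn⟩ := hmem x
      exact Subtype.ext (hinj n hn x hxn (smul_eq_of_mem_cornerSpace e₂_mul_e₂ hx)
        (congrArg Subtype.val h0))
    · rintro ⟨y, hy⟩
      obtain ⟨n, hn, hyn⟩ := hmem y
      have := (hc' n hn).finite
      obtain ⟨x, -, hx, hxy⟩ := exists_arrow_smul_eq (hc' n hn).defect_eq_zero (hinj n hn) hyn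
        (smul_eq_of_mem_cornerSpace e₁_mul_e₁ hy)
      exact ⟨⟨x, x, hx⟩, Subtype.ext hxy⟩
  obtain ⟨P, _, _, _, _, ⟨e⟩⟩ := exists_polyRep_equiv hbij
  obtain ⟨v, hv, hsurj⟩ := exists_isUniserialAt_of_chain (b := b) (P := P) hp0
    (c := fun n => (c n).map e.symm.toLinearMap) (fun i j hij => Submodule.map_mono (hmono hij))
    (by rw [← Submodule.map_iSup, htop, Submodule.map_top, LinearEquiv.range])
    (fun n hn => (hc' n hn).map e.symm)
  obtain ⟨r⟩ := nonempty_end_ringEquiv_powerSeries k hv.torsion hsurj hv.ne_zero hv.smul_eq_zero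
    fun w hw => by
      obtain ⟨f, hf⟩ := Submodule.mem_span_singleton.1 (hv.mem_span w hw)
      exact ⟨f, hf.symm⟩
  obtain ⟨s⟩ := PolyRep.nonempty_end_ringEquiv (k := k) b P
  exact ⟨(e.symm.conjRingEquiv.trans s).trans r⟩

theorem exists_isPrufer (hp : Irreducible p) {U : Type w} [AddCommGroup U]
    [Module (KroneckerAlgebra k) U]
    (f : PolyRep k b (k[X] ⧸ Ideal.span {p}) ≃ₗ[KroneckerAlgebra k] U) :
    ∃ (M : Type u) (_ : AddCommGroup M) (_ : Module k M) (_ : Module (KroneckerAlgebra k) M)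
      (_ : IsScalarTower k (KroneckerAlgebra k) M), IsPrufer k M U := by
  obtain ⟨P, _, _, _, _, v, hv, hsurj⟩ := exists_divisible_isUniserialAt hp
  exact ⟨PolyRep k b P, inferInstance, inferInstance, inferInstance, inferInstance,
    isPrufer_polyRep hv hp.ne_zero hsurj b f⟩

end Prufer

/-! ### Identification of `V` and `V_p`, and the conclusion -/

section Models

variable {k : Type u} [Field k]

/-- `V_p` as the representation of a `k[X]`-module. -/
noncomputable def polyRepEquivVp (p : k[X]) :
    PolyRep k false (k[X] ⧸ Ideal.span {p}) ≃ₗ[KroneckerAlgebra k] Vp p where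
  toFun m := m
  invFun m := m
  map_add' _ _ := rfl
  map_smul' r m := by
    refine Prod.ext ?_ rfl
    obtain ⟨m₁, m₂⟩ := m
    obtain ⟨f, rfl⟩ := Ideal.Quotient.mk_surjective m₂
    change r.a • m₁ + r.c • ((1 : k[X]) • Ideal.Quotient.mk _ f) +
        r.d • ((X : k[X]) • Ideal.Quotient.mk _ f)
      = r.a • m₁ + r.c • Ideal.Quotient.mk _ f +
        r.d • (Ideal.Quotient.mk _ (X * f : k[X]))
    rw [one_smul]
    rfl
  left_inv _ := rfl
  right_inv _ := rfl

/-- `V` as the representation of a `k[X]`-module. -/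
noncomputable def polyRepEquivV :
    PolyRep k true (k[X] ⧸ Ideal.span {(X - C 0 : k[X])}) ≃ₗ[KroneckerAlgebra k] V k :=
  let ε : (k[X] ⧸ Ideal.span {(X - C 0 : k[X])}) ≃ₗ[k] k :=
    (quotientSpanXSubCAlgEquiv (0 : k)).toLinearEquiv
  { ε.prodCongr ε with
    map_smul' := fun r m => by
      refine Prod.ext ?_ (map_smul ε _ _)
      change ε (r.a • m.1 + r.c • (X : k[X]) • m.2 + r.d • (1 : k[X]) • m.2) =
        r.a • ε m.1 + r.c • (0 : k) + r.d • ε m.2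
      rw [X_smul_quotient, one_smul, LinearEquiv.map_add, LinearEquiv.map_add,
        LinearEquiv.map_smul, LinearEquiv.map_smul, LinearEquiv.map_smul, LinearEquiv.map_zero] }

end Models

/-- Ring isomorphisms induce isomorphisms of power series rings. -/
theorem nonempty_powerSeries_ringEquiv {A B : Type*} [CommRing A] [CommRing B] (e : A ≃+* B) :
    Nonempty (PowerSeries A ≃+* PowerSeries B) :=
  ⟨RingEquiv.ofRingHom (PowerSeries.map e.toRingHom) (PowerSeries.map e.symm.toRingHom)
    (by ext; simp) (by ext; simp)⟩

end KroneckerAlgebra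

theorem corollary4p4 (k : Type u) [Field k] :
    ((∃ (M : Type u) (_ : AddCommGroup M) (_ : Module k M) (_ : Module (KroneckerAlgebra k) M)
        (_ : IsScalarTower k (KroneckerAlgebra k) M),
        KroneckerAlgebra.IsPrufer k M (KroneckerAlgebra.V k)) ∧
      ∀ (M : Type v) [AddCommGroup M] [Module k M] [Module (KroneckerAlgebra k) M]
        [IsScalarTower k (KroneckerAlgebra k) M],
        KroneckerAlgebra.IsPrufer k M (KroneckerAlgebra.V k) →
          Nonempty (Module.End (KroneckerAlgebra k) M ≃+* PowerSeries k)) ∧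
    ∀ p : k[X], p.Monic → Irreducible p →
      (∃ (M : Type u) (_ : AddCommGroup M) (_ : Module k M) (_ : Module (KroneckerAlgebra k) M)
        (_ : IsScalarTower k (KroneckerAlgebra k) M),
        KroneckerAlgebra.IsPrufer k M (KroneckerAlgebra.Vp p)) ∧
      ∀ (M : Type v) [AddCommGroup M] [Module k M] [Module (KroneckerAlgebra k) M]
        [IsScalarTower k (KroneckerAlgebra k) M],
        KroneckerAlgebra.IsPrufer k M (KroneckerAlgebra.Vp p) →
          Nonempty (Module.End (KroneckerAlgebra k) M ≃+* PowerSeries (AdjoinRoot p)) := by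
  refine ⟨?_, fun p _ hp => ?_⟩
  -- `V` is the case of the prime `X` with the roles of the arrows exchanged; the form `X - C 0`
  -- fits `quotientSpanXSubCAlgEquiv`.
  · have hirr : Irreducible (X - C 0 : k[X]) := irreducible_X_sub_C 0
    have hmax : (Ideal.span {(X - C 0 : k[X])}).IsMaximal :=
      PrincipalIdealRing.isMaximal_of_irreducible hirr
    refine ⟨KroneckerAlgebra.exists_isPrufer hirr KroneckerAlgebra.polyRepEquivV, ?_⟩
    intro M _ _ _ _ h
    obtain ⟨r⟩ := h.nonempty_end_ringEquiv hirr.ne_zero KroneckerAlgebra.polyRepEquivV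
    obtain ⟨s⟩ := KroneckerAlgebra.nonempty_powerSeries_ringEquiv
      (quotientSpanXSubCAlgEquiv (0 : k)).toRingEquiv
    exact ⟨r.trans s⟩
  · have hmax : (Ideal.span {p}).IsMaximal := PrincipalIdealRing.isMaximal_of_irreducible hp
    refine ⟨KroneckerAlgebra.exists_isPrufer hp (KroneckerAlgebra.polyRepEquivVp p), ?_⟩
    intro M _ _ _ _ h
    exact h.nonempty_end_ringEquiv hp.ne_zero (KroneckerAlgebra.polyRepEquivVp p)
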